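/- **Setting.** Let $M$ be a (connected) Riemann surface, $n\ge 2$, $r\in\{1,\dots,n-1\}$, and let $F_0\subseteq\mathbb C^n$ be a complex subspace of dimension $k$. For a subspace (or subbundle) $F$ let $\pi_F,\pi_F^\perp$ be the orthogonal projections onto $F$ and $F^\perp$ for the standard Hermitian product. "Rank" of the span of finitely many sections built from meromorphic data means the dimension of the span of their values off a closed discrete subset of $M$; such a span is completed to a bundle over the exceptional points by taking limits. $f^{(t)}$ denotes the $t$-th derivative in a local complex coordinate. An $r\times n$ *$F_0$-array* is a family $(K_{i,j})_{0\le i\le r-1,\,1\le j\le n}$ of $\mathbb C^n$-valued meromorphic functions on $M$ such that for each $j$ either $K_{i,j}$ has values in $F_0$ for all even $i$ and in $F_0^\perp$ for all odd $i$, or the other way round. Put $H_{0,j}=K_{0,j}$ and $H_{i,j}=\sum_{s=1}^{i}(-1)^{s+i}\binom{i-1}{s-1}K_{s,j}$ for $i\ge1$. Define bundles $\underline\alpha_1,\dots,\underline\alpha_r$ recursively: with $\pi_m=\pi_{\underline\alpha_m}$ and $C^i_s=\sum_{1\le i_1<\dots<i_s\le i}\pi_{i_s}^\perp\cdots\pi_{i_1}^\perp$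 ($C^i_0=I$), the bundle $\underline\alpha_{i+1}$ is spanned by $$\alpha^{(q)}_{i+1,j}=\sum_{s=q}^{i}C^i_s H^{(q)}_{s-q,j}\qquad(1\le j\le n,\ 0\le q\le i).$$ Put $\phi_i=(\pi_{F_0}-\pi_{F_0}^\perp)(\pi_1-\pi_1^\perp)\cdots(\pi_i-\pi_i^\perp)$ for $0\le i\le r$. Let $L=(l_a^t)$, $S=(s_a^t)$ ($a,t\ge0$, $a+t\le r-1$) be a pair of lower triangular $r\times r$ matrices of non-negative integers, the entry with indices $a,t$ standing in row $a+t$ and column $a$ (counted from $0$). Put $A_i=\sum_{a<i}(l_a^0+s_a^0)$ and $B_i=A_i+l_i^0$. $(L,S)$ is *adapted to $F_0$* (along the array $K$) if $l_a^t$ and $s_a^t$ are decreasing in $t$; for each $0\le i\le r-1$ the rank of $\underline\alpha_{i+1}$ is the sum $\sum_{m=0}^{i}\sum_{t=0}^{m}(l_t^{m-t}+s_t^{m-t})$ of all entries of both matrices in the rows $0,\dots,i$; the sum of all entries of $L$ is at most $k$, that of $S$ at most $n-k$, and that of both at most $n-1$. The array $K$ *matches* $(L,S)$ if for each $0\le i\le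 r-1$: 1. $K_{i,c}$ has values in $F_0$ for $A_i<c\le B_i$ and in $F_0^\perp$ for $B_i<c\le A_{i+1}$, and $K_{a,c}=0$ for all $a<i$ and $A_i<c\le A_{i+1}$; 2. for each $0\le a\le i$, the vectors $C^i_iK^{(i-a)}_{a,c}$ with $A_a<c\le B_a$ have a span of rank $l_a^{i-a}$, and those with $B_a<c\le A_{a+1}$ a span of rank $s_a^{i-a}$; 3. the vectors $C^i_iK^{(i-a)}_{a,c}$ with $0\le a\le i$, $A_a<c\le B_a$ have a span of rank $\sum_{a=0}^{i}l_a^{i-a}$, and those with $0\le a\le i$, $B_a<c\le A_{a+1}$ a span of rank $\sum_{a=0}^{i}s_a^{i-a}$. **Theorem.** Let $(L,S)$ be adapted to $F_0$ along an $F_0$-array $K$ that matches $(L,S)$. Then for every $i\in\{0,\dots,r\}$ the map $\phi_i$ takes values in the Grassmannian, that is, $\phi_i=\pi_{\underline F_i}-\pi_{\underline F_i}^\perp$ on $M$ with $\underline F_i$ the $(+1)$-eigenbundle of $\phi_i$ (the tautological bundle of $\phi_i$), and at every point of $M$ $$\operatorname{rank}\underline F_i=\begin{cases}\displaystyle k+\sum_{j=0}^{\frac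 i2-1}\sum_{t=0}^{2j+1}\bigl(s_t^{2j+1-t}-l_t^{2j+1-t}\bigr)&\text{if $i$ is even,}\\[2ex]\displaystyle n-\Bigl[k+\sum_{j=0}^{\frac{i-1}2}\sum_{t=0}^{2j}\bigl(s_t^{2j-t}-l_t^{2j-t}\bigr)\Bigr]&\text{if $i$ is odd.}\end{cases}$$ -/

import Mathlib

open scoped Manifold ContDiff Topology

noncomputable section

namespace GrassUniton

/-- `ℂⁿ` with its standard Hermitian inner product. -/
abbrev Cn (n : ℕ) : Type := EuclideanSpace ℂ (Fin n)

section Surface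

variable {n : ℕ} {M : Type*} [TopologicalSpace M] [ChartedSpace ℂ M]

/-- A `ℂⁿ`-valued meromorphic function on the Riemann surface `M`: it is meromorphic at every
point when read in a local coordinate. (As always in Mathlib, its values at its poles carry no
information; all conditions on such functions are imposed off a closed discrete set.) -/
def IsMeromorphic (f : M → Cn n) : Prop :=
  ∀ p : M, MeromorphicAt (f ∘ (chartAt ℂ p).symm) (chartAt ℂ p p)

/-- The `k`-th derivative `f^{(k)}` at `p`, with respect to a local complex coordinate at `p`. -/
def derivAt (k : ℕ) (f : M → Cn n) (p : M) : Cn n :=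
  iteratedDeriv k (f ∘ (chartAt ℂ p).symm) (chartAt ℂ p p)

/-- The family `V` of subspaces of `ℂⁿ` has (generic) rank `m`: its members have dimension `m` at
all points off a closed discrete subset of `M`. -/
def HasRank (V : M → Submodule ℂ (Cn n)) (m : ℕ) : Prop :=
  ∀ᶠ p in Filter.codiscrete M, Module.finrank ℂ (V p) = m

/-- The meromorphic function `f` takes values in the constant subspace `F`. -/
def ValuedIn (F : Submodule ℂ (Cn n)) (f : M → Cn n) : Prop :=
  ∀ᶠ p in Filter.codiscrete M, f p ∈ F

/-- The limit at `p` of the subspaces `W q`, as `q → p` with `q ≠ p`. This is how a family of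
subspaces spanned by meromorphic sections is completed to a bundle over the isolated points at
which some section has a pole or the dimension of the span drops. -/
def limitSpace (W : M → Submodule ℂ (Cn n)) (p : M) : Submodule ℂ (Cn n) where
  carrier := {v | ∃ w : M → Cn n, (∀ᶠ q in 𝓝[≠] p, w q ∈ W q) ∧
    Filter.Tendsto w (𝓝[≠] p) (𝓝 v)}
  zero_mem' := ⟨fun _ => 0, Filter.Eventually.of_forall fun q => (W q).zero_mem,
    tendsto_const_nhds⟩
  add_mem' := by
    rintro a b ⟨u, hu, hua⟩ ⟨v, hv, hvb⟩
    refine ⟨fun q => u q + v q, ?_, hua.add hvb⟩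
    filter_upwards [hu, hv] with q h1 h2
    exact (W q).add_mem h1 h2
  smul_mem' := by
    rintro c a ⟨u, hu, hua⟩
    refine ⟨fun q => c • u q, ?_, hua.const_smul c⟩
    filter_upwards [hu] with q h1
    exact (W q).smul_mem c h1

end Surface

section Algebra

variable {n : ℕ}

/-- The Cartan embedding `F ↦ π_F - π_F^⊥` of the Grassmannian into `U(n)`. -/
def cartan (F : Submodule ℂ (Cn n)) : Cn n →L[ℂ] Cn n :=
  F.starProjection - Fᗮ.starProjection

/-- For a list `[α_i, …, α_1]` of subspaces, the `s`-th elementary function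
`C^i_s = ∑_{i_1 < ⋯ < i_s} π_{i_s}^⊥ ⋯ π_{i_1}^⊥` (the identity if `s = 0`, zero if `s > i`). -/
def elemFun (s : ℕ) (α : List (Submodule ℂ (Cn n))) : Cn n →L[ℂ] Cn n :=
  ((α.sublistsLen s).map fun β => (β.map fun V : Submodule ℂ (Cn n) => Vᗮ.starProjection).prod).sum

end Algebra

section Construction

variable {n : ℕ} {M : Type*} [TopologicalSpace M] [ChartedSpace ℂ M]

/-- The functions `H_{i,j}` obtained from the array `K`: `H_{0,j} = K_{0,j}` and
`H_{i,j} = ∑_{s=1}^i (-1)^{s+i} binom(i-1, s-1) K_{s,j}` for `i ≥ 1`. -/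
def dataH (K : ℕ → Fin n → M → Cn n) (i : ℕ) (j : Fin n) (p : M) : Cn n :=
  if i = 0 then K 0 j p
  else ∑ s ∈ Finset.Icc 1 i, ((-1 : ℂ) ^ (s + i) * ((i - 1).choose (s - 1) : ℂ)) • K s j p

/-- The vector `α_{i+1,j}^{(k)} = ∑_{s=k}^i C^i_s H_{s-k,j}^{(k)}` at `p`, where `α` is the list
`[α_i, …, α_1]` of fibres at `p`. -/
def genVec (K : ℕ → Fin n → M → Cn n) (i : ℕ) (α : List (Submodule ℂ (Cn n)))
    (j : Fin n) (k : ℕ) (p : M) : Cn n :=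
  ∑ s ∈ Finset.Icc k i, elemFun s α (derivAt k (dataH K (s - k) j) p)

/-- The list `[α_i, …, α_1]` of the fibres at `p` of the first `i` unitons of the array `K`; here
`α_{i+1}` is the bundle spanned by the `α_{i+1,j}^{(k)}` with `1 ≤ j ≤ n` and `0 ≤ k ≤ i`. -/
def unitonList (K : ℕ → Fin n → M → Cn n) : ℕ → M → List (Submodule ℂ (Cn n))
  | 0, _ => []
  | i + 1, p =>
    limitSpace (fun q => Submodule.span ℂ
      {v | ∃ j : Fin n, ∃ k ≤ i, v = genVec K i (unitonList K i q) j k q}) p :: unitonList K i p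

/-- The fibre at `p` of the uniton `α_{i+1}` (note the shift of the index). -/
def unitonSucc (K : ℕ → Fin n → M → Cn n) (i : ℕ) (p : M) : Submodule ℂ (Cn n) :=
  limitSpace (fun q => Submodule.span ℂ
    {v | ∃ j : Fin n, ∃ k ≤ i, v = genVec K i (unitonList K i q) j k q}) p

theorem unitonList_succ (K : ℕ → Fin n → M → Cn n) (i : ℕ) (p : M) :
    unitonList K (i + 1) p = unitonSucc K i p :: unitonList K i p := rfl

/-- The partial map `φ_i = (π_{F₀} - π_{F₀}^⊥)(π_1 - π_1^⊥) ⋯ (π_i - π_i^⊥)`. -/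
def partialMap (F₀ : Submodule ℂ (Cn n)) (K : ℕ → Fin n → M → Cn n) :
    ℕ → M → (Cn n →L[ℂ] Cn n)
  | 0, _ => cartan F₀
  | i + 1, p => partialMap F₀ K i p * cartan (unitonSucc K i p)

/-- The tautological bundle of a map `φ` into the Grassmannian: if `φ(p) = π_F - π_F^⊥`, its fibre
at `p` is `F`, the eigenspace of `φ(p)` for the eigenvalue `1`. -/
def tautological (φ : M → (Cn n →L[ℂ] Cn n)) (p : M) : Submodule ℂ (Cn n) :=
  Module.End.eigenspace (φ p : Cn n →ₗ[ℂ] Cn n) 1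

/-- `F₀`-arrays with rows `0, …, r-1` (the rows `K i` with `i ≥ r` are irrelevant): meromorphic
`ℂⁿ`-valued functions such that the entries of each column lie alternately in `F₀` and `F₀ᗮ`. -/
structure IsF0Array (F₀ : Submodule ℂ (Cn n)) (r : ℕ) (K : ℕ → Fin n → M → Cn n) : Prop where
  meromorphic : ∀ i < r, ∀ j, IsMeromorphic (K i j)
  alternating : ∀ j,
    (∀ i < r, (Even i → ValuedIn F₀ (K i j)) ∧ (Odd i → ValuedIn F₀ᗮ (K i j))) ∨
    (∀ i < r, (Even i → ValuedIn F₀ᗮ (K i j)) ∧ (Odd i → ValuedIn F₀ (K i j)))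

/-- `A_i = ∑_{a < i} (l_a^0 + s_a^0)`. The triangular matrices `L`, `S` are given by their entries
`l a t = l_a^t` and `s a t = s_a^t`, `a + t ≤ r - 1`; here `l_a^t` stands in row `a + t` and column
`a` (counted from `0`). -/
def blockStart (l s : ℕ → ℕ → ℕ) (i : ℕ) : ℕ := ∑ a ∈ Finset.range i, (l a 0 + s a 0)

/-- The columns (counted from `0`) `A_i ≤ c < B_i = A_i + l_i^0`. -/
def blockL (n : ℕ) (l s : ℕ → ℕ → ℕ) (i : ℕ) : Set (Fin n) :=
  {c | blockStart l s i ≤ c ∧ (c : ℕ) < blockStart l s i + l i 0}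

/-- The columns (counted from `0`) `B_i ≤ c < B_i + s_i^0 = A_{i+1}`. -/
def blockS (n : ℕ) (l s : ℕ → ℕ → ℕ) (i : ℕ) : Set (Fin n) :=
  {c | blockStart l s i + l i 0 ≤ c ∧ (c : ℕ) < blockStart l s (i + 1)}

/-- The pair `(L, S)` of triangular `r × r` matrices is adapted to `F₀` (along the array `K`):
the columns are decreasing; the sum of all entries of both matrices in the rows `0, …, i` is the
rank of `α_{i+1}`; the entries of `L` sum up to at most `dim F₀`, those of `S` to at most
`n - dim F₀`, and those of both to at most `n - 1`. -/
structure IsAdapted (F₀ : Submodule ℂ (Cn n)) (r : ℕ) (l s : ℕ → ℕ → ℕ)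
    (K : ℕ → Fin n → M → Cn n) : Prop where
  decreasing_l : ∀ a t, a + (t + 1) < r → l a (t + 1) ≤ l a t
  decreasing_s : ∀ a t, a + (t + 1) < r → s a (t + 1) ≤ s a t
  rank_uniton : ∀ i < r, HasRank (unitonSucc K i)
    (∑ m ∈ Finset.range (i + 1), ∑ t ∈ Finset.range (m + 1), (l t (m - t) + s t (m - t)))
  sum_l : ∑ m ∈ Finset.range r, ∑ t ∈ Finset.range (m + 1), l t (m - t) ≤ Module.finrank ℂ F₀
  sum_s : ∑ m ∈ Finset.range r, ∑ t ∈ Finset.range (m + 1), s t (m - t) ≤ Module.finrank ℂ F₀ᗮ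
  sum_lt : ∑ m ∈ Finset.range r, ∑ t ∈ Finset.range (m + 1), (l t (m - t) + s t (m - t)) < n

/-- The vectors `C^i_i K_{a,c}^{(i-a)}` at `p`, for the columns `c ∈ B`. -/
def topVecs (K : ℕ → Fin n → M → Cn n) (i a : ℕ) (B : Set (Fin n)) (p : M) : Set (Cn n) :=
  (fun c => elemFun i (unitonList K i p) (derivAt (i - a) (K a c) p)) '' B

/-- The array `K` matches the ordered pair `(L, S)`. -/
structure Matches (F₀ : Submodule ℂ (Cn n)) (r : ℕ) (l s : ℕ → ℕ → ℕ)
    (K : ℕ → Fin n → M → Cn n) : Prop where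
  /-- Above row `i`, the columns of the `i`-th block vanish. -/
  vanish : ∀ i < r, ∀ a < i, ∀ c ∈ blockL n l s i ∪ blockS n l s i,
    ∀ᶠ p in Filter.codiscrete M, K a c p = 0
  valued_l : ∀ i < r, ∀ c ∈ blockL n l s i, ValuedIn F₀ (K i c)
  valued_s : ∀ i < r, ∀ c ∈ blockS n l s i, ValuedIn F₀ᗮ (K i c)
  rank_l : ∀ i < r, ∀ a ≤ i, HasRank
    (fun p => Submodule.span ℂ (topVecs K i a (blockL n l s a) p)) (l a (i - a))
  rank_s : ∀ i < r, ∀ a ≤ i, HasRank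
    (fun p => Submodule.span ℂ (topVecs K i a (blockS n l s a) p)) (s a (i - a))
  rank_sum_l : ∀ i < r, HasRank
    (fun p => Submodule.span ℂ (⋃ a ∈ Finset.range (i + 1), topVecs K i a (blockL n l s a) p))
    (∑ a ∈ Finset.range (i + 1), l a (i - a))
  rank_sum_s : ∀ i < r, HasRank
    (fun p => Submodule.span ℂ (⋃ a ∈ Finset.range (i + 1), topVecs K i a (blockS n l s a) p))
    (∑ a ∈ Finset.range (i + 1), s a (i - a))

end Construction

end GrassUniton

end

/-! Let Φ_i = (π_1 + λπ_1^⊥)⋯(π_i + λπ_i^⊥) act on power series in λ, and let L_j = ∑ K_{m,j} λ^m, m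
< r, be the series of the j-th column. The recursion for the unitons is a Grassmannian model in
disguise. At a generic point, the series u for which Φ_i⁻¹u has no negative powers of λ form W_i,
the span of all λ^m L_j^{(d)} with d ≤ m and of the multiples of λ^i (`wSpace_eq_regSpace`). The
fibre of α_{i+1} consists of the constant coefficients of Φ_i⁻¹w with w ∈ W_{i+1}
(`spanSucc_eq_map_resid`). The binomial coefficients in H come from λπ + π^⊥ = λ + (1 - λ)π^⊥.

Since the columns alternate between F_0 and its complement, u(λ) ↦ (π_{F_0} - π_{F_0}^⊥)u(-λ)
preserves W_i. Carried through Φ_i⁻¹, it becomes φ_i on constant coefficients. So φ_i preserves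
α_{i+1} and commutes with π_{i+1}, and φ_{i+1} is again a self-adjoint involution
(`partialMap_spec`).

The (+1)-eigenspace of φ_{i+1} is the sum of the parts of α_{i+1} and α_{i+1}^⊥ on which φ_i is +1
and -1 respectively. Hence rank F_{i+1} + rank F_i = n + a_i - b_i, where a_i and b_i are the
dimensions of the intersections of α_{i+1} with the eigenspaces of φ_i for 1 and -1. The image under
π_i of either intersection contains the corresponding one for α_i and φ_{i-1} (`le_map_proj`). The
kernel contains the vectors C^i_i K_{a,c}^{(i-a)}, which have eigenvalue (-1)^i for columns starting
in F_0 and -(-1)^i for the others (`topVec_mem`). This bounds a_i and b_i from below. The bounds add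
up to the rank of α_{i+1}, so both are sharp (`finrank_inf_eig`), and the recursion can be solved.

To reach every point, a span of meromorphic functions is written as the range of projections that
extend analytically over the poles (`exists_analytic_projection`). This makes the unitons, and thus
φ_i, continuous. As the rank is (trace φ_i + n)/2, generic identities hold everywhere. -/

noncomputable section

namespace GrassUniton

/-! ### Power series in λ, the factors of Φ_i, and residues -/

section Series

variable {n : ℕ}

/-- Formal power series in one variable `λ` with coefficients in `ℂⁿ`. -/
abbrev Ser (n : ℕ) : Type := ℕ → Cn n

/-- Multiplication of a power series by `λ`. -/
def shift : Module.End ℂ (Ser n) where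
  toFun u m := if m = 0 then 0 else u (m - 1)
  map_add' u v := by ext1 m; by_cases h : m = 0 <;> simp [h]
  map_smul' c u := by ext1 m; by_cases h : m = 0 <;> simp [h]

/-- An endomorphism of `ℂⁿ` acting on the coefficients of power series. -/
def onCoeff (T : Cn n →L[ℂ] Cn n) : Module.End ℂ (Ser n) :=
  (T : Cn n →ₗ[ℂ] Cn n).compLeft ℕ

@[simp] lemma onCoeff_apply (T : Cn n →L[ℂ] Cn n) (u : Ser n) (m : ℕ) :
    onCoeff T u m = T (u m) := rfl

@[simp] lemma shift_zero (u : Ser n) : shift u 0 = 0 := rfl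

@[simp] lemma shift_succ (u : Ser n) (m : ℕ) : shift u (m + 1) = u m := rfl

lemma onCoeff_mul (S T : Cn n →L[ℂ] Cn n) : onCoeff (S * T) = onCoeff S * onCoeff T := rfl

lemma onCoeff_one : onCoeff (1 : Cn n →L[ℂ] Cn n) = 1 := rfl

lemma onCoeff_add (S T : Cn n →L[ℂ] Cn n) : onCoeff (S + T) = onCoeff S + onCoeff T := rfl

lemma onCoeff_zero : onCoeff (0 : Cn n →L[ℂ] Cn n) = 0 := rfl

lemma commute_shift_onCoeff (T : Cn n →L[ℂ] Cn n) : Commute shift (onCoeff T) := by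
  refine LinearMap.ext fun u => funext fun m => ?_
  cases m <;> simp [Module.End.mul_apply]

lemma shift_pow_apply (k : ℕ) (u : Ser n) (m : ℕ) :
    (shift ^ k) u m = if m < k then 0 else u (m - k) := by
  induction k generalizing m with
  | zero => simp
  | succ k ih =>
    rw [pow_succ', Module.End.mul_apply]
    cases m with
    | zero => simp
    | succ m => simp [ih]

lemma mem_range_shift_pow {k : ℕ} {u : Ser n} :
    u ∈ LinearMap.range (shift ^ k : Module.End ℂ (Ser n)) ↔ ∀ m < k, u m = 0 := by
  constructor
  · rintro ⟨v, rfl⟩ m hm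
    simp [shift_pow_apply, hm]
  · intro h
    refine ⟨fun m => u (m + k), funext fun m => ?_⟩
    rw [shift_pow_apply]
    split_ifs with hm
    · exact (h m hm).symm
    · congr 1; omega

lemma shift_injective : Function.Injective (shift : Module.End ℂ (Ser n)) := fun u v h =>
  funext fun m => by simpa using congrFun h (m + 1)

lemma shift_pow_injective (k : ℕ) : Function.Injective (shift ^ k : Module.End ℂ (Ser n)) := by
  rw [Module.End.coe_pow]
  exact shift_injective.iterate k

lemma range_shift_pow_anti {k m : ℕ} (h : k ≤ m) :
    LinearMap.range (shift ^ m : Module.End ℂ (Ser n)) ≤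
      LinearMap.range (shift ^ k : Module.End ℂ (Ser n)) := fun _ hu =>
  mem_range_shift_pow.2 fun j hj => mem_range_shift_pow.1 hu j (hj.trans_le h)

/-- The partial sums of the coefficients, that is, multiplication by `(1 - λ)⁻¹`. -/
def partialSums : Module.End ℂ (Ser n) where
  toFun u m := ∑ j ∈ Finset.range (m + 1), u j
  map_add' u v := by ext1 m; simp [Finset.sum_add_distrib]
  map_smul' c u := by ext1 m; simp [Finset.smul_sum]

lemma partialSums_eq : (partialSums : Module.End ℂ (Ser n)) = 1 + shift * partialSums := by
  refine LinearMap.ext fun u => funext fun m => ?_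
  cases m with
  | zero => simp [partialSums, Module.End.mul_apply]
  | succ m =>
    change ∑ j ∈ Finset.range (m + 1 + 1), u j = u (m + 1) + ∑ j ∈ Finset.range (m + 1), u j
    rw [Finset.sum_range_succ, add_comm]

lemma commute_partialSums_onCoeff (T : Cn n →L[ℂ] Cn n) :
    Commute partialSums (onCoeff T) := by
  refine LinearMap.ext fun u => funext fun m => ?_
  simp [Module.End.mul_apply, partialSums]

lemma commute_partialSums_shift : Commute partialSums (shift : Module.End ℂ (Ser n)) := by
  refine LinearMap.ext fun u => funext fun m => ?_
  cases m with
  | zero => simp [Module.End.mul_apply, partialSums]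
  | succ m => simp [Module.End.mul_apply, partialSums, Finset.sum_range_succ' _ (m + 1)]

lemma one_sub_shift_mul_partialSums :
    (1 - shift) * (partialSums : Module.End ℂ (Ser n)) = 1 := by
  rw [sub_mul, one_mul, sub_eq_iff_eq_add]
  exact partialSums_eq

/-- The factor `λ π_V + π_V^⊥`. -/
def lowFactor (V : Submodule ℂ (Cn n)) : Module.End ℂ (Ser n) :=
  shift * onCoeff V.starProjection + onCoeff Vᗮ.starProjection

/-- The factor `π_V + λ π_V^⊥`. -/
def upFactor (V : Submodule ℂ (Cn n)) : Module.End ℂ (Ser n) :=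
  onCoeff V.starProjection + shift * onCoeff Vᗮ.starProjection

/-- `(λ π_i + π_i^⊥) ⋯ (λ π_1 + π_1^⊥)` for the list `[α_i, …, α_1]`. -/
def lowProd : List (Submodule ℂ (Cn n)) → Module.End ℂ (Ser n)
  | [] => 1
  | V :: l => lowFactor V * lowProd l

/-- `(π_1 + λ π_1^⊥) ⋯ (π_i + λ π_i^⊥)` for the list `[α_i, …, α_1]`. -/
def upProd : List (Submodule ℂ (Cn n)) → Module.End ℂ (Ser n)
  | [] => 1
  | V :: l => upProd l * upFactor V

lemma proj_mul_self (V : Submodule ℂ (Cn n)) :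
    V.starProjection * V.starProjection = V.starProjection :=
  V.isIdempotentElem_starProjection

lemma proj_mul_perp (V : Submodule ℂ (Cn n)) : V.starProjection * Vᗮ.starProjection = 0 := by
  rw [Submodule.starProjection_orthogonal', mul_sub, mul_one, proj_mul_self, sub_self]

lemma perp_mul_proj (V : Submodule ℂ (Cn n)) : Vᗮ.starProjection * V.starProjection = 0 := by
  rw [Submodule.starProjection_orthogonal', sub_mul, one_mul, proj_mul_self, sub_self]

lemma proj_add_perp (V : Submodule ℂ (Cn n)) : V.starProjection + Vᗮ.starProjection = 1 := by
  rw [Submodule.starProjection_orthogonal', add_sub_cancel]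

/-- Stated for two complementary idempotents, so that exchanging them gives the product in the other
order. -/
lemma onCoeff_factor_aux (A B : Cn n →L[ℂ] Cn n) (hA : A * A = A) (hB : B * B = B)
    (hAB : A * B = 0) (hBA : B * A = 0) (h : A + B = 1) :
    (shift * onCoeff A + onCoeff B) * (onCoeff A + shift * onCoeff B) = shift := by
  have cA := (commute_shift_onCoeff A).eq
  have cB := (commute_shift_onCoeff B).eq
  have e1 : shift * onCoeff A * onCoeff A = shift * onCoeff A := by
    rw [mul_assoc, ← onCoeff_mul, hA]
  have e2 : shift * onCoeff A * (shift * onCoeff B) = 0 := by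
    rw [mul_assoc, ← mul_assoc (onCoeff A), ← cA, mul_assoc, ← onCoeff_mul, hAB]; simp [onCoeff_zero]
  have e3 : onCoeff B * onCoeff A = 0 := by rw [← onCoeff_mul, hBA]; rfl
  have e4 : onCoeff B * (shift * onCoeff B) = shift * onCoeff B := by
    rw [← mul_assoc, ← cB, mul_assoc, ← onCoeff_mul, hB]
  rw [add_mul, mul_add, mul_add, e1, e2, e3, e4, add_zero, zero_add, ← mul_add, ← onCoeff_add, h,
    onCoeff_one, mul_one]

lemma lowFactor_mul_upFactor (V : Submodule ℂ (Cn n)) : lowFactor V * upFactor V = shift :=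
  onCoeff_factor_aux _ _ (proj_mul_self V) (proj_mul_self Vᗮ) (proj_mul_perp V) (perp_mul_proj V)
    (proj_add_perp V)

lemma upFactor_mul_lowFactor (V : Submodule ℂ (Cn n)) : upFactor V * lowFactor V = shift := by
  have h := onCoeff_factor_aux _ _ (proj_mul_self Vᗮ) (proj_mul_self V) (perp_mul_proj V)
    (proj_mul_perp V) ((add_comm _ _).trans (proj_add_perp V))
  rw [upFactor, lowFactor, add_comm (onCoeff V.starProjection),
    add_comm (shift * onCoeff V.starProjection)]
  exact h

lemma commute_shift_lowFactor (V : Submodule ℂ (Cn n)) : Commute shift (lowFactor V) :=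
  ((Commute.refl _).mul_right (commute_shift_onCoeff _)).add_right (commute_shift_onCoeff _)

lemma commute_shift_upFactor (V : Submodule ℂ (Cn n)) : Commute shift (upFactor V) :=
  (commute_shift_onCoeff _).add_right ((Commute.refl _).mul_right (commute_shift_onCoeff _))

lemma commute_shift_lowProd (l : List (Submodule ℂ (Cn n))) : Commute shift (lowProd l) := by
  induction l with
  | nil => exact Commute.one_right _
  | cons V l ih => exact (commute_shift_lowFactor V).mul_right ih

lemma commute_shift_upProd (l : List (Submodule ℂ (Cn n))) : Commute shift (upProd l) := by
  induction l with
  | nil => exact Commute.one_right _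
  | cons V l ih => exact ih.mul_right (commute_shift_upFactor V)

lemma commute_partialSums_lowProd (l : List (Submodule ℂ (Cn n))) :
    Commute partialSums (lowProd l) := by
  induction l with
  | nil => exact Commute.one_right _
  | cons V l ih =>
    exact ((commute_partialSums_shift.mul_right (commute_partialSums_onCoeff _)).add_right
      (commute_partialSums_onCoeff _)).mul_right ih

/-- Thus `lowProd l` is λ^i Φ_i⁻¹, with i the length of `l`; the factor λ^i avoids Laurent series.
-/
lemma lowProd_mul_upProd (l : List (Submodule ℂ (Cn n))) :
    lowProd l * upProd l = shift ^ l.length := by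
  induction l with
  | nil => rfl
  | cons V l ih =>
    rw [lowProd, upProd, mul_assoc, ← mul_assoc (lowProd l), ih,
      ((commute_shift_upFactor V).pow_left _).eq, ← mul_assoc, lowFactor_mul_upFactor,
      List.length_cons, pow_succ']

lemma upProd_mul_lowProd (l : List (Submodule ℂ (Cn n))) :
    upProd l * lowProd l = shift ^ l.length := by
  induction l with
  | nil => rfl
  | cons V l ih =>
    rw [lowProd, upProd, mul_assoc, ← mul_assoc (upFactor V), upFactor_mul_lowFactor,
      ← mul_assoc, ← (commute_shift_upProd l).eq, mul_assoc, ih, List.length_cons, pow_succ']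

/-- The constant coefficient of `(π_i + λ⁻¹ π_i^⊥) ⋯ (π_1 + λ⁻¹ π_1^⊥) u`. -/
def resid (l : List (Submodule ℂ (Cn n))) : Ser n →ₗ[ℂ] Cn n :=
  LinearMap.proj l.length ∘ₗ lowProd l

lemma resid_apply (l : List (Submodule ℂ (Cn n))) (u : Ser n) :
    resid l u = lowProd l u l.length := rfl

lemma lowProd_shift_pow (l : List (Submodule ℂ (Cn n))) (k : ℕ) (u : Ser n) :
    lowProd l ((shift ^ k) u) = (shift ^ k) (lowProd l u) :=
  (LinearMap.congr_fun ((commute_shift_lowProd l).pow_left k).eq u).symm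

lemma resid_of_mem_range {l : List (Submodule ℂ (Cn n))} {u : Ser n}
    (hu : u ∈ LinearMap.range (shift ^ (l.length + 1) : Module.End ℂ (Ser n))) :
    resid l u = 0 := by
  obtain ⟨v, rfl⟩ := hu
  rw [resid_apply, lowProd_shift_pow]
  simp [shift_pow_apply]

/-- The constant power series. -/
def constSer : Cn n →ₗ[ℂ] Ser n := LinearMap.single ℂ (fun _ => Cn n) 0

lemma constSer_zero (v : Cn n) : constSer v 0 = v := by simp [constSer]

/-- On the image of Φ_i the residue reads off the constant coefficient, so applying Φ_i to constants
splits the residue. -/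
lemma resid_upProd (l : List (Submodule ℂ (Cn n))) (v : Ser n) :
    resid l (upProd l v) = v 0 := by
  rw [resid_apply, ← Module.End.mul_apply, lowProd_mul_upProd, shift_pow_apply]
  simp

/-- The subspace of the power series `u` for which `(π_i + λ⁻¹ π_i^⊥) ⋯ (π_1 + λ⁻¹ π_1^⊥) u` has no
negative powers of `λ`. -/
def regSpace (l : List (Submodule ℂ (Cn n))) : Submodule ℂ (Ser n) :=
  (LinearMap.range (shift ^ l.length : Module.End ℂ (Ser n))).comap (lowProd l)

lemma mem_regSpace {l : List (Submodule ℂ (Cn n))} {u : Ser n} :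
    u ∈ regSpace l ↔ ∀ m < l.length, lowProd l u m = 0 := mem_range_shift_pow

lemma shift_mem_regSpace {l : List (Submodule ℂ (Cn n))} {u : Ser n} (hu : u ∈ regSpace l) :
    shift u ∈ regSpace l ∧ resid l (shift u) = 0 := by
  have h : lowProd l (shift u) = shift (lowProd l u) := by simpa using lowProd_shift_pow l 1 u
  rw [mem_regSpace] at *
  have key : ∀ m < l.length + 1, lowProd l (shift u) m = 0 := by
    rintro (_ | m) hm
    · simp [h]
    · rw [h, shift_succ]; exact hu m (by omega)
  exact ⟨fun m hm => key m (by omega), key _ (by omega)⟩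

/-- If λ^i Φ_i⁻¹u starts in order i + 1, it is λ^{i+1}w, and u = λΦ_i w because λ^i can be
cancelled. -/
lemma exists_shift_of_resid_eq_zero {l : List (Submodule ℂ (Cn n))} {u : Ser n}
    (hu : u ∈ regSpace l) (h0 : resid l u = 0) : ∃ v ∈ regSpace l, u = shift v := by
  have h1 : ∀ m < l.length + 1, lowProd l u m = 0 := fun m hm => by
    rcases Nat.lt_succ_iff_lt_or_eq.1 hm with h | rfl
    · exact mem_regSpace.1 hu m h
    · exact h0
  obtain ⟨w, hw⟩ := mem_range_shift_pow.2 h1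
  have h2 : (shift ^ l.length) u = (shift ^ l.length) (shift (upProd l w)) := by
    rw [← upProd_mul_lowProd, Module.End.mul_apply, ← hw, ← Module.End.mul_apply,
      ← ((commute_shift_upProd l).pow_left _).eq, pow_succ, Module.End.mul_apply,
      Module.End.mul_apply, upProd_mul_lowProd]
  have h3 := shift_pow_injective _ h2
  refine ⟨_, mem_regSpace.2 fun m hm => ?_, h3⟩
  rw [← Module.End.mul_apply, lowProd_mul_upProd, shift_pow_apply, if_pos hm]

lemma upProd_mem_regSpace (l : List (Submodule ℂ (Cn n))) (v : Ser n) :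
    upProd l v ∈ regSpace l := mem_regSpace.2 fun m hm => by
  rw [← Module.End.mul_apply, lowProd_mul_upProd, shift_pow_apply, if_pos hm]

lemma lowFactor_zero (V : Submodule ℂ (Cn n)) (u : Ser n) :
    lowFactor V u 0 = Vᗮ.starProjection (u 0) := by
  simp [lowFactor, Module.End.mul_apply]

lemma lowFactor_succ (V : Submodule ℂ (Cn n)) (u : Ser n) (m : ℕ) :
    lowFactor V u (m + 1) = V.starProjection (u m) + Vᗮ.starProjection (u (m + 1)) := by
  simp [lowFactor, Module.End.mul_apply]

/-- The factor λπ_V + π_V^⊥ moves the V-component of each coefficient up by one order and keeps the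
V^⊥-component. So the orders 0, …, i of the product vanish exactly when the V-components vanish
below order i and the V^⊥-components up to order i. The only condition beyond `regSpace l` is that
the coefficient of order i, which is the residue, lies in V. -/
lemma mem_regSpace_cons {V : Submodule ℂ (Cn n)} {l : List (Submodule ℂ (Cn n))} {u : Ser n} :
    u ∈ regSpace (V :: l) ↔ u ∈ regSpace l ∧ resid l u ∈ V := by
  constructor
  · intro hu
    have hu' : ∀ m < l.length + 1, lowFactor V (lowProd l u) m = 0 := mem_regSpace.1 hu
    have key : ∀ m < l.length + 1, Vᗮ.starProjection (lowProd l u m) = 0 ∧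
        (m < l.length → lowProd l u m = 0) := by
      intro m hm
      have hperp : Vᗮ.starProjection (lowProd l u m) = 0 := by
        cases m with
        | zero => simpa [lowFactor_zero] using hu' 0 hm
        | succ m =>
          have := congrArg Vᗮ.starProjection (hu' (m + 1) hm)
          rw [lowFactor_succ, map_add, map_zero] at this
          have e1 : Vᗮ.starProjection (V.starProjection (lowProd l u m)) = 0 :=
            DFunLike.congr_fun (perp_mul_proj V) _
          have e2 : Vᗮ.starProjection (Vᗮ.starProjection (lowProd l u (m + 1))) =
            Vᗮ.starProjection (lowProd l u (m + 1)) := DFunLike.congr_fun (proj_mul_self Vᗮ) _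
          rwa [e1, e2, zero_add] at this
      refine ⟨hperp, fun hm' => ?_⟩
      have := congrArg V.starProjection (hu' (m + 1) (by omega))
      rw [lowFactor_succ, map_add, map_zero] at this
      have e1 : V.starProjection (V.starProjection (lowProd l u m)) =
        V.starProjection (lowProd l u m) := DFunLike.congr_fun (proj_mul_self V) _
      have e2 : V.starProjection (Vᗮ.starProjection (lowProd l u (m + 1))) = 0 :=
        DFunLike.congr_fun (proj_mul_perp V) _
      rw [e1, e2, add_zero] at this
      have h1 : (V.starProjection + Vᗮ.starProjection) (lowProd l u m) = 0 := by
        rw [add_apply, this, hperp, add_zero]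
      rwa [proj_add_perp] at h1
    refine ⟨mem_regSpace.2 fun m hm => (key m (by omega)).2 hm, ?_⟩
    have := (key l.length (by omega)).1
    rw [Submodule.starProjection_apply_eq_zero_iff, Submodule.orthogonal_orthogonal] at this
    exact this
  · rintro ⟨hu, hV⟩
    have hperp : Vᗮ.starProjection (lowProd l u l.length) = 0 := by
      rw [Submodule.starProjection_apply_eq_zero_iff, Submodule.orthogonal_orthogonal]
      exact hV
    refine mem_regSpace.2 fun m hm => ?_
    change lowFactor V (lowProd l u) m = 0
    rw [mem_regSpace] at hu
    rw [List.length_cons] at hm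
    have hall : ∀ m < l.length + 1, Vᗮ.starProjection (lowProd l u m) = 0 := fun m hm => by
      rcases Nat.lt_succ_iff_lt_or_eq.1 hm with h | rfl
      · rw [hu m h, map_zero]
      · exact hperp
    cases m with
    | zero => rw [lowFactor_zero, hall 0 hm]
    | succ m => rw [lowFactor_succ, hall _ hm, hu m (by omega), map_zero, add_zero]

end Series

/-! ### The spaces W_i generated by the columns -/

section Filtration

variable {n : ℕ}

/-- The space of power series spanned by `λ^m L_{d,j}`, `d ≤ m`, and the multiples of `λ^i`. -/
def wSpace (L : ℕ → Fin n → Ser n) (i : ℕ) : Submodule ℂ (Ser n) :=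
  Submodule.span ℂ {u | ∃ j d m, d ≤ m ∧ u = (shift ^ m) (L d j)} ⊔ LinearMap.range (shift ^ i)

lemma range_shift_le_wSpace (L : ℕ → Fin n → Ser n) (i : ℕ) :
    LinearMap.range (shift ^ i) ≤ wSpace L i := le_sup_right

lemma shift_pow_mem_wSpace (L : ℕ → Fin n → Ser n) (i : ℕ) (j : Fin n) {d m : ℕ} (h : d ≤ m) :
    (shift ^ m) (L d j) ∈ wSpace L i :=
  Submodule.mem_sup_left (Submodule.subset_span ⟨j, d, m, h, rfl⟩)

lemma wSpace_le {L : ℕ → Fin n → Ser n} {i : ℕ} {U : Submodule ℂ (Ser n)}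
    (h1 : ∀ j d m, d ≤ m → (shift ^ m) (L d j) ∈ U) (h2 : LinearMap.range (shift ^ i) ≤ U) :
    wSpace L i ≤ U :=
  sup_le (Submodule.span_le.2 (by rintro _ ⟨j, d, m, h, rfl⟩; exact h1 j d m h)) h2

lemma wSpace_anti (L : ℕ → Fin n → Ser n) {i k : ℕ} (h : i ≤ k) : wSpace L k ≤ wSpace L i :=
  sup_le_sup_left (range_shift_pow_anti h) _

lemma shift_mem_wSpace {L : ℕ → Fin n → Ser n} {i : ℕ} {u : Ser n} (hu : u ∈ wSpace L i) :
    shift u ∈ wSpace L (i + 1) := by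
  have : wSpace L i ≤ (wSpace L (i + 1)).comap shift := by
    refine wSpace_le (fun j d m h => ?_) ?_
    · rw [Submodule.mem_comap, ← Module.End.mul_apply, ← pow_succ']
      exact shift_pow_mem_wSpace L _ j (by omega)
    · rintro _ ⟨v, rfl⟩
      rw [Submodule.mem_comap, ← Module.End.mul_apply, ← pow_succ']
      exact range_shift_le_wSpace L _ ⟨v, rfl⟩
  exact this hu

lemma wSpace_zero (L : ℕ → Fin n → Ser n) : wSpace L 0 = regSpace [] :=
  le_antisymm (fun _ _ => mem_regSpace.2 fun _ h => absurd h (Nat.not_lt_zero _))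
    fun u _ => range_shift_le_wSpace L 0 ⟨u, rfl⟩

/-- Inductive step of the model. An element u of the larger-looking space has the residue of some w
in W_{i+1}; then u - w is λ times an element of W_i, and λW_i lies in W_{i+1}. -/
lemma wSpace_eq_regSpace_cons {L : ℕ → Fin n → Ser n} {l : List (Submodule ℂ (Cn n))}
    {V : Submodule ℂ (Cn n)} (h : wSpace L l.length = regSpace l)
    (hV : V = (wSpace L (l.length + 1)).map (resid l)) :
    wSpace L (l.length + 1) = regSpace (V :: l) := by
  refine le_antisymm (fun u hu => mem_regSpace_cons.2 ⟨?_, ?_⟩) fun u hu => ?_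
  · rw [← h]; exact wSpace_anti L (Nat.le_succ _) hu
  · rw [hV]; exact Submodule.mem_map_of_mem hu
  · obtain ⟨hu1, hu2⟩ := mem_regSpace_cons.1 hu
    rw [hV] at hu2
    obtain ⟨w, hw, hwu⟩ := hu2
    have hw' : w ∈ regSpace l := by rw [← h]; exact wSpace_anti L (Nat.le_succ _) hw
    obtain ⟨v, hv, hv'⟩ := exists_shift_of_resid_eq_zero (sub_mem hu1 hw')
      (by rw [map_sub, hwu, sub_self])
    rw [← sub_add_cancel u w, hv']
    rw [← h] at hv
    exact add_mem (shift_mem_wSpace hv) hw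

lemma partialSums_mem_regSpace {l : List (Submodule ℂ (Cn n))} {u : Ser n} (hu : u ∈ regSpace l) :
    partialSums u ∈ regSpace l := by
  rw [mem_regSpace] at *
  intro m hm
  have h := LinearMap.congr_fun (commute_partialSums_lowProd l).eq u
  rw [Module.End.mul_apply, Module.End.mul_apply] at h
  rw [← h]
  change ∑ j ∈ Finset.range (m + 1), lowProd l u j = 0
  exact Finset.sum_eq_zero fun j hj => hu j (by rw [Finset.mem_range] at hj; omega)

/-- Since (1 - λ)⁻¹ = 1 + λ(1 - λ)⁻¹, each factor changes u only by λ times an element of `regSpace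
l`, which has residue zero. -/
lemma resid_partialSums_pow {l : List (Submodule ℂ (Cn n))} {u : Ser n} (hu : u ∈ regSpace l)
    (k : ℕ) : (partialSums ^ k) u ∈ regSpace l ∧ resid l ((partialSums ^ k) u) = resid l u := by
  induction k with
  | zero => exact ⟨hu, rfl⟩
  | succ k ih =>
    rw [pow_succ', Module.End.mul_apply]
    refine ⟨partialSums_mem_regSpace ih.1, ?_⟩
    have h := LinearMap.congr_fun (partialSums_eq (n := n)) ((partialSums ^ k) u)
    rw [h, LinearMap.add_apply, map_add, Module.End.one_apply, Module.End.mul_apply,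
      (shift_mem_regSpace (partialSums_mem_regSpace ih.1)).2, add_zero, ih.2]

lemma resid_shift_partialSums {L : ℕ → Fin n → Ser n} {l : List (Submodule ℂ (Cn n))}
    (h : wSpace L l.length = regSpace l) (j : Fin n) {k m : ℕ} :
    resid l ((shift ^ k) ((partialSums ^ m) (L k j))) = resid l ((shift ^ k) (L k j)) := by
  have hmem : (shift ^ k) (L k j) ∈ regSpace l := by
    rw [← h]; exact shift_pow_mem_wSpace L _ j le_rfl
  rw [← Module.End.mul_apply, ← ((commute_partialSums_shift.pow_left m).pow_right k).eq,
    Module.End.mul_apply, (resid_partialSums_pow hmem m).2]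

/-- Only the generators with d = m ≤ i contribute: for d < m ≤ i a factor λ splits off from an
element of W_i, which kills the residue, and multiples of λ^{i+1} have none. -/
lemma map_resid_wSpace {L : ℕ → Fin n → Ser n} {l : List (Submodule ℂ (Cn n))}
    (h : wSpace L l.length = regSpace l) :
    (wSpace L (l.length + 1)).map (resid l) =
      Submodule.span ℂ {v | ∃ j, ∃ k ≤ l.length, v = resid l ((shift ^ k) (L k j))} := by
  apply le_antisymm
  · rw [Submodule.map_le_iff_le_comap]
    refine wSpace_le (fun j d m hdm => ?_) fun u hu => ?_
    · rw [Submodule.mem_comap]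
      by_cases hm : m ≤ l.length
      · rcases hdm.eq_or_lt with rfl | hlt
        · exact Submodule.subset_span ⟨j, d, hm, rfl⟩
        · obtain ⟨m, rfl⟩ : ∃ m', m = m' + 1 := ⟨m - 1, by omega⟩
          have hmem : (shift ^ m) (L d j) ∈ regSpace l := by
            rw [← h]; exact shift_pow_mem_wSpace L _ j (by omega)
          rw [pow_succ', Module.End.mul_apply, (shift_mem_regSpace hmem).2]
          exact zero_mem _
      · rw [resid_of_mem_range (range_shift_pow_anti (by omega : l.length + 1 ≤ m) ⟨_, rfl⟩)]
        exact zero_mem _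
    · rw [Submodule.mem_comap, resid_of_mem_range hu]
      exact zero_mem _
  · rw [Submodule.span_le]
    rintro _ ⟨j, k, _, rfl⟩
    exact Submodule.mem_map_of_mem (shift_pow_mem_wSpace L _ j le_rfl)

end Filtration

/-! ### The elementary functions C^i_s and the binomial combinations H -/

section ElementaryFunctions

variable {n : ℕ}

lemma elemFun_zero (l : List (Submodule ℂ (Cn n))) : elemFun 0 l = 1 := by
  simp [elemFun]

lemma elemFun_succ_cons (s : ℕ) (V : Submodule ℂ (Cn n)) (l : List (Submodule ℂ (Cn n))) :
    elemFun (s + 1) (V :: l) = elemFun (s + 1) l + Vᗮ.starProjection * elemFun s l := by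
  simp [elemFun, List.sublistsLen_succ_cons, List.sum_map_mul_left, Function.comp_def]

lemma elemFun_of_length_lt {s : ℕ} {l : List (Submodule ℂ (Cn n))} (h : l.length < s) :
    elemFun s l = 0 := by
  simp [elemFun, List.sublistsLen_of_length_lt h]

/-- Every factor equals λ + (1 - λ)π^⊥; expanding the product collects the C^i_s. -/
lemma lowProd_eq_sum (l : List (Submodule ℂ (Cn n))) :
    lowProd l = ∑ s ∈ Finset.range (l.length + 1),
      onCoeff (elemFun s l) * (shift ^ (l.length - s) * (1 - shift) ^ s) := by
  induction l with
  | nil => simp [lowProd, elemFun_zero, onCoeff_one]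
  | cons V l ih =>
    have hfac : lowFactor V = shift + onCoeff Vᗮ.starProjection * (1 - shift) := by
      have h : V.starProjection = 1 - Vᗮ.starProjection := eq_sub_of_add_eq (proj_add_perp V)
      have h' : onCoeff V.starProjection = 1 - onCoeff Vᗮ.starProjection := by
        rw [h]; rfl
      rw [lowFactor, h', mul_sub, mul_sub, mul_one, mul_one,
        (commute_shift_onCoeff Vᗮ.starProjection).eq]
      abel
    have e1 : shift * lowProd l = ∑ s ∈ Finset.range (l.length + 1),
        onCoeff (elemFun s l) * (shift ^ (l.length + 1 - s) * (1 - shift) ^ s) := by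
      rw [ih, Finset.mul_sum]
      refine Finset.sum_congr rfl fun s hs => ?_
      rw [Finset.mem_range] at hs
      rw [← mul_assoc, (commute_shift_onCoeff _).eq, mul_assoc, ← mul_assoc, ← mul_assoc,
        show l.length + 1 - s = l.length - s + 1 by omega, pow_succ', mul_assoc, mul_assoc,
        mul_assoc]
    have e2 : onCoeff Vᗮ.starProjection * (1 - shift) * lowProd l =
        ∑ s ∈ Finset.range (l.length + 1), onCoeff (Vᗮ.starProjection * elemFun s l) *
          (shift ^ (l.length - s) * (1 - shift) ^ (s + 1)) := by
      have hc : Commute (1 - shift : Module.End ℂ (Ser n)) shift :=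
        (Commute.one_left _).sub_left (Commute.refl _)
      have hc' (T : Cn n →L[ℂ] Cn n) : Commute (1 - shift : Module.End ℂ (Ser n)) (onCoeff T) :=
        (Commute.one_left _).sub_left (commute_shift_onCoeff T)
      rw [ih, Finset.mul_sum]
      refine Finset.sum_congr rfl fun s hs => ?_
      rw [onCoeff_mul, mul_assoc, mul_assoc, ← mul_assoc (1 - shift), (hc' _).eq, mul_assoc,
        ← mul_assoc (1 - shift), (hc.pow_right _).eq, mul_assoc, ← pow_succ']
    rw [lowProd, hfac, add_mul, e1, e2, List.length_cons, Finset.sum_range_succ' _ (l.length + 1),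
      Finset.sum_range_succ' _ l.length]
    simp only [elemFun_succ_cons, onCoeff_add, add_mul, Finset.sum_add_distrib, elemFun_zero]
    rw [Finset.sum_range_succ (fun k => onCoeff (elemFun (k + 1) l) * _) l.length,
      elemFun_of_length_lt (Nat.lt_succ_self l.length), onCoeff_zero, zero_mul, add_zero]
    simp only [Nat.add_sub_add_right]
    abel

/-- The value at a power series `u` of the combinations by which the array `H` arises from `K`. -/
def serH (u : Ser n) (i : ℕ) : Cn n :=
  if i = 0 then u 0
  else ∑ s ∈ Finset.Icc 1 i, ((-1 : ℂ) ^ (s + i) * ((i - 1).choose (s - 1) : ℂ)) • u s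

/-- The combination H_{i+1} is the coefficient of λ^{i+1} in (1 - λ)^i u, which is where its signed
binomials come from. -/
lemma one_sub_shift_pow_apply (u : Ser n) (i : ℕ) :
    ((1 - shift) ^ i) u (i + 1) = serH u (i + 1) := by
  have h : ((1 - shift) ^ i : Module.End ℂ (Ser n)) =
      ∑ s ∈ Finset.range (i + 1), ((-1 : ℂ) ^ s * (i.choose s : ℂ)) • shift ^ s := by
    have e : (1 - shift : Module.End ℂ (Ser n)) = (-1 : ℂ) • shift + 1 := by
      refine LinearMap.ext fun v => funext fun m => ?_
      simp [sub_eq_neg_add]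
    rw [e, (Commute.one_right _).add_pow]
    refine Finset.sum_congr rfl fun s _ => ?_
    rw [one_pow, mul_one, smul_pow, ← nsmul_eq_mul', ← Nat.cast_smul_eq_nsmul ℂ, smul_smul,
      mul_comm]
  rw [h, LinearMap.sum_apply, Finset.sum_apply, serH, if_neg (Nat.succ_ne_zero i)]
  refine Finset.sum_nbij' (fun s => i + 1 - s) (fun s => i + 1 - s) ?_ ?_ ?_ ?_ ?_
  · intro s hs; simp only [Finset.mem_range, Finset.mem_Icc] at *; omega
  · intro s hs; simp only [Finset.mem_range, Finset.mem_Icc] at *; omega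
  · intro s hs; simp only [Finset.mem_range] at *; omega
  · intro s hs; simp only [Finset.mem_Icc] at *; omega
  · intro s hs
    rw [Finset.mem_range] at hs
    have e1 : (-1 : ℂ) ^ (i + 1 - s + (i + 1)) = (-1) ^ s := by
      rw [show i + 1 - s + (i + 1) = 2 * (i + 1 - s) + s by omega, pow_add, pow_mul]
      simp
    have e2 : (i + 1 - 1).choose (i + 1 - s - 1) = i.choose s := by
      rw [show i + 1 - s - 1 = i - s by omega, Nat.add_sub_cancel]
      exact Nat.choose_symm (by omega)
    rw [e1, e2, LinearMap.smul_apply, Pi.smul_apply, shift_pow_apply, if_neg (by omega)]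

/-- The given generators of the uniton are residues. In the expansion of λ^i Φ_i⁻¹ the power (1 -
λ)^s meets (1 - λ)^{-(k+1)}, leaving the exponent s - k - 1 that belongs to H_{s-k}. -/
lemma sum_elemFun_serH (l : List (Submodule ℂ (Cn n))) (u : Ser n) (k : ℕ) :
    ∑ s ∈ Finset.Icc k l.length, elemFun s l (serH u (s - k)) =
      resid l ((shift ^ k) ((partialSums ^ (k + 1)) u)) := by
  have hinv (s : ℕ) : (1 - shift : Module.End ℂ (Ser n)) ^ s * partialSums ^ s = 1 := by
    have hc : Commute (1 - shift : Module.End ℂ (Ser n)) partialSums :=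
      (Commute.one_left _).sub_left commute_partialSums_shift.symm
    rw [← hc.mul_pow, one_sub_shift_mul_partialSums, one_pow]
  have hc (s k : ℕ) : Commute ((1 - shift : Module.End ℂ (Ser n)) ^ s) (shift ^ k) :=
    ((Commute.one_left _).sub_left (Commute.refl _)).pow_pow _ _
  rw [resid_apply, lowProd_eq_sum, LinearMap.sum_apply, Finset.sum_apply]
  have hsub : Finset.Icc k l.length ⊆ Finset.range (l.length + 1) := fun s hs => by
    simp only [Finset.mem_range, Finset.mem_Icc] at *; omega
  rw [← Finset.sum_subset hsub]
  · refine Finset.sum_congr rfl fun s hs => ?_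
    obtain ⟨hk, hs⟩ := Finset.mem_Icc.1 hs
    rw [Module.End.mul_apply, onCoeff_apply]
    congr 1
    simp only [← Module.End.mul_apply]
    rw [mul_assoc, ← mul_assoc _ (shift ^ k), (hc s k).eq, mul_assoc, ← mul_assoc, ← pow_add,
      Module.End.mul_apply, shift_pow_apply, if_neg (by omega),
      show l.length - (l.length - s + k) = s - k by omega]
    obtain ⟨d, rfl⟩ := Nat.exists_eq_add_of_le hk
    rw [Nat.add_sub_cancel_left]
    cases d with
    -- For s = k a factor (1 - λ)⁻¹ remains. It does not affect the constant coefficient, in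
    -- accordance with H_0 = K_0.
    | zero =>
      rw [add_zero, pow_succ, ← mul_assoc, hinv, one_mul, serH, if_pos rfl]
      simp [partialSums]
    | succ d =>
      rw [show k + (d + 1) = d + (k + 1) by omega, pow_add, mul_assoc, hinv, mul_one,
        one_sub_shift_pow_apply]
  -- For s < k the summand is divisible by λ^{i-s+k}, so it has no coefficient of order i.
  · intro s hs hs'
    simp only [Finset.mem_range, Finset.mem_Icc] at *
    rw [Module.End.mul_apply, onCoeff_apply]
    simp only [← Module.End.mul_apply]
    rw [mul_assoc, ← mul_assoc _ (shift ^ k), (hc s k).eq, mul_assoc, ← mul_assoc, ← pow_add,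
      Module.End.mul_apply, shift_pow_apply, if_pos (by omega), map_zero]

end ElementaryFunctions

/-! ### Analytic projections onto spans of meromorphic functions -/

section Idempotents

/-- Generators are added one at a time. The part of the new generator not captured by P, namely f -
Pf, either vanishes near z₀ or equals (z - z₀)^m g with g analytic and g(z₀) ≠ 0; the direction g is
then added to the range of P. The projections are oblique, since orthogonal ones would not be
holomorphic. -/
lemma exists_analytic_projection {E : Type*} [NormedAddCommGroup E] [NormedSpace ℂ E]
    [CompleteSpace E] {ι : Type*} (s : Finset ι) (f : ι → ℂ → E) (z₀ : ℂ)
    (hf : ∀ k ∈ s, MeromorphicAt (f k) z₀) :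
    ∃ P : ℂ → E →L[ℂ] E, AnalyticAt ℂ P z₀ ∧ ∀ᶠ z in 𝓝[≠] z₀,
      (∀ u, P z u ∈ Submodule.span ℂ ((f · z) '' s)) ∧
      ∀ u ∈ Submodule.span ℂ ((f · z) '' s), P z u = u := by
  classical
  induction s using Finset.induction_on with
  | empty => exact ⟨0, analyticAt_const, by simp⟩
  | insert a s _ ih =>
    obtain ⟨P, hP, hPs⟩ := ih fun k hk => hf k (Finset.mem_insert_of_mem hk)
    have hfa := hf a (Finset.mem_insert_self a s)
    have hPf : MeromorphicAt (fun z => P z (f a z)) z₀ := by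
      obtain ⟨N, hN⟩ := hfa
      refine ⟨N, ?_⟩
      exact (((ContinuousLinearMap.id ℂ (E →L[ℂ] E)).analyticAt_bilinear _).comp
        (hP.prod hN)).congr (.of_forall fun z => map_smul (P z) _ _)
    have hb : MeromorphicAt (fun z => f a z - P z (f a z)) z₀ := hfa.sub hPf
    have hspan (z : ℂ) : Submodule.span ℂ ((f · z) '' (insert a s : Finset ι)) =
        Submodule.span ℂ {f a z} ⊔ Submodule.span ℂ ((f · z) '' s) := by
      rw [Finset.coe_insert, Set.image_insert_eq, Submodule.span_insert]
    rcases hb.eventually_eq_zero_or_eventually_ne_zero with h0 | hne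
    · refine ⟨P, hP, ?_⟩
      filter_upwards [hPs, h0] with z hz hz0
      have hfz : f a z ∈ Submodule.span ℂ ((f · z) '' s) := by
        rw [sub_eq_zero.1 hz0]; exact hz.1 _
      have : Submodule.span ℂ {f a z} ⊔ Submodule.span ℂ ((f · z) '' s) =
          Submodule.span ℂ ((f · z) '' s) :=
        sup_eq_right.2 ((Submodule.span_singleton_le_iff_mem _ _).2 hfz)
      rw [hspan, this]
      exact hz
    · have hord : meromorphicOrderAt (fun z => f a z - P z (f a z)) z₀ ≠ ⊤ :=
        (meromorphicOrderAt_ne_top_iff_eventually_ne_zero hb).2 hne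
      obtain ⟨g, hg, hg0, hgb⟩ := (meromorphicOrderAt_ne_top_iff hb).1 hord
      set m := (meromorphicOrderAt (fun z => f a z - P z (f a z)) z₀).untop₀
      obtain ⟨τ, -, hτ⟩ := exists_dual_vector ℂ (g z₀) (norm_ne_zero_iff.2 hg0)
      have hτ0 : τ (g z₀) ≠ 0 := by rw [hτ]; simpa using hg0
      have hτg : AnalyticAt ℂ (fun z => τ (g z)) z₀ := τ.analyticAt _ |>.comp hg
      -- The correction is the rank-one map u ↦ τ(u - Pu)/τ(g) · g: it vanishes where P is the
      -- identity, and supplies f - Pf when u = f.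
      let Q : ℂ → E →L[ℂ] E := fun z =>
        P z + (τ (g z))⁻¹ • (τ.comp (ContinuousLinearMap.id ℂ E - P z)).smulRight (g z)
      have hQ : AnalyticAt ℂ Q z₀ := by
        have h1 : AnalyticAt ℂ (fun z => τ.comp (ContinuousLinearMap.id ℂ E - P z)) z₀ :=
          ((ContinuousLinearMap.compL ℂ E E ℂ τ).analyticAt _).comp (analyticAt_const.sub hP)
        have h2 : AnalyticAt ℂ (fun z =>
            (τ.comp (ContinuousLinearMap.id ℂ E - P z)).smulRight (g z)) z₀ :=
          ((ContinuousLinearMap.smulRightL ℂ E E).analyticAt_bilinear _).comp (h1.prod hg)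
        exact hP.add ((hτg.inv hτ0).smul h2)
      refine ⟨Q, hQ, ?_⟩
      have hτne : ∀ᶠ z in 𝓝[≠] z₀, τ (g z) ≠ 0 :=
        (hτg.continuousAt.eventually_ne hτ0).filter_mono nhdsWithin_le_nhds
      filter_upwards [hPs, hgb, hτne, self_mem_nhdsWithin] with z hz hzb hzτ hzz
      have hzm : (z - z₀) ^ m ≠ 0 := zpow_ne_zero _ (sub_ne_zero.2 hzz)
      have hQz (u : E) : Q z u = P z u + ((τ (g z))⁻¹ * τ (u - P z u)) • g z := by
        simp [Q, mul_smul]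
      rw [hspan]
      have hfz : f a z ∈ Submodule.span ℂ {f a z} ⊔ Submodule.span ℂ ((f · z) '' s) :=
        Submodule.mem_sup_left (Submodule.mem_span_singleton_self _)
      have hPz (u : E) : P z u ∈ Submodule.span ℂ {f a z} ⊔ Submodule.span ℂ ((f · z) '' s) :=
        Submodule.mem_sup_right (hz.1 u)
      have hgz : g z ∈ Submodule.span ℂ {f a z} ⊔ Submodule.span ℂ ((f · z) '' s) := by
        have h := Submodule.smul_mem _ ((z - z₀) ^ m)⁻¹ (sub_mem hfz (hPz (f a z)))
        rwa [hzb, inv_smul_smul₀ hzm] at h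
      refine ⟨fun u => ?_, fun u hu => ?_⟩
      · rw [hQz]
        exact add_mem (hPz u) (Submodule.smul_mem _ _ hgz)
      · have hle : Submodule.span ℂ {f a z} ⊔ Submodule.span ℂ ((f · z) '' s) ≤
            LinearMap.eqLocus (Q z : E →ₗ[ℂ] E) LinearMap.id := by
          refine sup_le ((Submodule.span_singleton_le_iff_mem _ _).2 ?_) fun w hw => ?_
          · change Q z (f a z) = f a z
            rw [hQz, hzb, map_smul, smul_eq_mul, mul_left_comm, inv_mul_cancel₀ hzτ, mul_one,
              ← hzb, add_sub_cancel]
          · change Q z w = w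
            rw [hQz, hz.2 w hw, sub_self, map_zero, mul_zero, zero_smul, add_zero]
        exact hle hu

end Idempotents

/-! ### Limits of subspaces and continuity of orthogonal projections -/

section Limits

variable {n : ℕ} {M : Type*} [TopologicalSpace M]

/-- If w_q ∈ W_q tends to v, then w_q = A_q w_q tends to A_p v as well, so A_p fixes the limits;
conversely A_p v is the limit of A_q v ∈ W_q. -/
lemma limitSpace_eq_range {W : M → Submodule ℂ (Cn n)} {A : M → Cn n →L[ℂ] Cn n} {p : M}
    [(𝓝[≠] p).NeBot] (hA : ContinuousAt A p)
    (hW : ∀ᶠ q in 𝓝[≠] p, (∀ v, A q v ∈ W q) ∧ ∀ v ∈ W q, A q v = v) :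
    (∀ v, A p v ∈ limitSpace W p) ∧ ∀ v ∈ limitSpace W p, A p v = v := by
  have hA' : Filter.Tendsto A (𝓝[≠] p) (𝓝 (A p)) := hA.tendsto.mono_left nhdsWithin_le_nhds
  have happ {w : M → Cn n} {v : Cn n} (hw : Filter.Tendsto w (𝓝[≠] p) (𝓝 v)) :
      Filter.Tendsto (fun q => A q (w q)) (𝓝[≠] p) (𝓝 (A p v)) :=
    (isBoundedBilinearMap_apply.continuous.tendsto (A p, v)).comp (hA'.prodMk_nhds hw)
  refine ⟨fun v => ⟨fun q => A q v, hW.mono fun q hq => hq.1 v, happ tendsto_const_nhds⟩, ?_⟩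
  rintro v ⟨w, hw, hwv⟩
  refine tendsto_nhds_unique ((happ hwv).congr' ?_) hwv
  filter_upwards [hw, hW] with q h1 h2 using h2.2 _ h1

/-- Passes from oblique to orthogonal projections. As A maps into U and B fixes V, π_U^⊥π_V =
π_U^⊥(B - A)π_V, and similarly with the roles exchanged; the difference of the projections is
(π_V^⊥π_U)^* - π_U^⊥π_V. -/
lemma norm_starProjection_sub_le {E : Type*} [NormedAddCommGroup E] [InnerProductSpace ℂ E]
    [FiniteDimensional ℂ E] {U V : Submodule ℂ E} {A B : E →L[ℂ] E}
    (hA : ∀ v, A v ∈ U) (hA' : ∀ v ∈ U, A v = v) (hB : ∀ v, B v ∈ V) (hB' : ∀ v ∈ V, B v = v) :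
    ‖U.starProjection - V.starProjection‖ ≤ 2 * ‖A - B‖ := by
  have key : ∀ {U V : Submodule ℂ E} {A B : E →L[ℂ] E}, (∀ v, A v ∈ U) → (∀ v ∈ V, B v = v) →
      ‖Uᗮ.starProjection * V.starProjection‖ ≤ ‖A - B‖ := by
    intro U V A B hA hB
    have e : Uᗮ.starProjection * V.starProjection =
        Uᗮ.starProjection * ((B - A) * V.starProjection) := by
      ext1 v
      have h1 : B (V.starProjection v) = V.starProjection v := hB _ (V.starProjection_apply_mem v)
      have h2 : Uᗮ.starProjection (A (V.starProjection v)) = 0 := by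
        rw [Submodule.starProjection_apply_eq_zero_iff, Submodule.orthogonal_orthogonal]
        exact hA _
      change Uᗮ.starProjection (V.starProjection v) =
        Uᗮ.starProjection (B (V.starProjection v) - A (V.starProjection v))
      rw [map_sub, h1, h2, sub_zero]
    rw [e]
    calc _ ≤ ‖Uᗮ.starProjection‖ * (‖B - A‖ * ‖V.starProjection‖) :=
          (norm_mul_le _ _).trans (by gcongr; exact norm_mul_le _ _)
      _ ≤ 1 * (‖B - A‖ * 1) := by
          gcongr
          · exact Submodule.starProjection_norm_le _
          · exact Submodule.starProjection_norm_le _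
      _ = ‖A - B‖ := by rw [one_mul, mul_one, norm_sub_rev]
  have e : U.starProjection - V.starProjection =
      star (Vᗮ.starProjection * U.starProjection) - Uᗮ.starProjection * V.starProjection := by
    rw [star_mul, (isSelfAdjoint_starProjection U).star_eq,
      (isSelfAdjoint_starProjection Vᗮ).star_eq, Submodule.starProjection_orthogonal',
      Submodule.starProjection_orthogonal']
    noncomm_ring
  rw [e, two_mul]
  refine (norm_sub_le _ _).trans (add_le_add ?_ (key hA hB'))
  rw [ContinuousLinearMap.star_eq_adjoint, LinearIsometryEquiv.norm_map, norm_sub_rev]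
  exact key hB hA'

lemma continuousAt_starProjection {U : M → Submodule ℂ (Cn n)} {A : M → Cn n →L[ℂ] Cn n} {p : M}
    (hA : ContinuousAt A p) (hU : ∀ᶠ q in 𝓝 p, (∀ v, A q v ∈ U q) ∧ ∀ v ∈ U q, A q v = v) :
    ContinuousAt (fun q => (U q).starProjection) p := by
  have hp := hU.self_of_nhds
  rw [ContinuousAt, tendsto_iff_norm_sub_tendsto_zero] at *
  refine squeeze_zero' (.of_forall fun _ => norm_nonneg _) ?_
    (by simpa using hA.const_mul 2)
  filter_upwards [hU] with q hq
  exact norm_starProjection_sub_le hq.1 hq.2 hp.1 hp.2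

lemma continuousAt_starProjection_orthogonal {U : M → Submodule ℂ (Cn n)} {p : M}
    (h : ContinuousAt (fun q => (U q).starProjection) p) :
    ContinuousAt (fun q => (U q)ᗮ.starProjection) p := by
  simp only [Submodule.starProjection_orthogonal']
  exact continuousAt_const.sub h

end Limits

/-! ### Properties holding off a closed discrete set -/

section Codiscrete

variable {X : Type*} [TopologicalSpace X]

lemma eventually_codiscrete_iff {P : X → Prop} :
    (∀ᶠ q in Filter.codiscrete X, P q) ↔ ∀ p, ∀ᶠ q in 𝓝[≠] p, P q := by
  change {q | P q} ∈ Filter.codiscrete X ↔ _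
  rw [mem_codiscrete]
  simp only [Filter.disjoint_principal_right, compl_compl]
  rfl

/-- Needed because derivatives at a point see a whole neighbourhood. -/
lemma eventually_codiscrete_nhds {P : X → Prop} (h : ∀ᶠ q in Filter.codiscrete X, P q) :
    ∀ᶠ q in Filter.codiscrete X, ∀ᶠ q' in 𝓝 q, P q' := by
  filter_upwards [h] with q hq
  have := eventually_codiscrete_iff.1 h q
  rw [eventually_nhdsWithin_iff] at this
  filter_upwards [this] with q' hq'
  by_cases e : q' = q
  · rwa [e]
  · exact hq' e

end Codiscrete

/-! ### Higher derivatives of composites -/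

section DerivativesOfComposites

variable {E : Type*} [NormedAddCommGroup E] [NormedSpace ℂ E] [CompleteSpace E]

/-- Only the shape of the chain rule matters: the orders do not exceed d, and the coefficients
depend on h but not on w. -/
lemma exists_iteratedDeriv_comp_eq_sum {h : ℂ → ℂ} {a : ℂ} (hh : AnalyticAt ℂ h a) (d : ℕ) :
    ∃ c : ℕ → ℂ → ℂ, (∀ e, AnalyticAt ℂ (c e) a) ∧ ∀ w : ℂ → E, AnalyticAt ℂ w (h a) →
      ∀ᶠ z in 𝓝 a, iteratedDeriv d (w ∘ h) z =
        ∑ e ∈ Finset.range (d + 1), c e z • iteratedDeriv e w (h z) := by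
  induction d with
  | zero => exact ⟨fun _ _ => 1, fun _ => analyticAt_const, fun w _ => .of_forall fun z => by simp⟩
  | succ d ih =>
    obtain ⟨c, hc, hcw⟩ := ih
    refine ⟨fun e z => (if e ≤ d then deriv (c e) z else 0) +
      (if e = 0 then 0 else deriv h z * c (e - 1) z), fun e => ?_, fun w hw => ?_⟩
    · refine AnalyticAt.add ?_ ?_
      · split_ifs
        exacts [(hc e).deriv, analyticAt_const]
      · split_ifs
        exacts [analyticAt_const, hh.deriv.mul (hc _)]
    · have hw' : ∀ᶠ z in 𝓝 a, AnalyticAt ℂ w (h z) :=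
        hh.continuousAt.eventually hw.eventually_analyticAt
      have hc' : ∀ᶠ z in 𝓝 a, ∀ e ∈ Finset.range (d + 1), AnalyticAt ℂ (c e) z :=
        (Filter.eventually_all_finset _).2 fun e _ => (hc e).eventually_analyticAt
      filter_upwards [(hcw w hw).eventually_nhds, hw', hc', hh.eventually_analyticAt] with
        z hz hwz hcz hhz
      rw [iteratedDeriv_succ, Filter.EventuallyEq.deriv_eq hz]
      have hder : ∀ e ∈ Finset.range (d + 1),
          HasDerivAt (fun z => c e z • iteratedDeriv e w (h z))
            (c e z • (deriv h z • iteratedDeriv (e + 1) w (h z)) +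
              deriv (c e) z • iteratedDeriv e w (h z)) z := by
        intro e he
        refine (hcz e he).differentiableAt.hasDerivAt.smul ?_
        have hwe : AnalyticAt ℂ (iteratedDeriv e w) (h z) := by
          rw [iteratedDeriv_eq_iterate]; exact hwz.iterated_deriv e
        rw [iteratedDeriv_succ]
        exact hwe.differentiableAt.hasDerivAt.scomp z hhz.differentiableAt.hasDerivAt
      rw [(HasDerivAt.fun_sum hder).deriv, Finset.sum_add_distrib]
      simp only [add_smul]
      rw [Finset.sum_add_distrib, add_comm]
      congr 1
      · rw [Finset.sum_range_succ _ (d + 1), if_neg (by omega), zero_smul, add_zero]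
        refine Finset.sum_congr rfl fun e he => ?_
        rw [if_pos (by rw [Finset.mem_range] at he; omega)]
      · rw [Finset.sum_range_succ' _ (d + 1), if_pos rfl, zero_smul, add_zero]
        refine Finset.sum_congr rfl fun e he => ?_
        rw [if_neg (Nat.succ_ne_zero e), Nat.add_sub_cancel, smul_smul, mul_comm]

lemma iteratedDeriv_clm_comp {F : Type*} [NormedAddCommGroup F] [NormedSpace ℂ F]
    (T : E →L[ℂ] F) {w : ℂ → E} {a : ℂ} (hw : AnalyticAt ℂ w a) (d : ℕ) :
    iteratedDeriv d (T ∘ w) a = T (iteratedDeriv d w a) := by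
  rw [iteratedDeriv_eq_iteratedFDeriv, iteratedDeriv_eq_iteratedFDeriv,
    T.iteratedFDeriv_comp_left (hw.contDiffAt (n := d)) le_rfl]
  rfl

end DerivativesOfComposites

/-! ### Holomorphic functions and change of coordinate -/

section Charts

variable {n : ℕ} {M : Type*} [TopologicalSpace M] [ChartedSpace ℂ M]

lemma nhdsNE_neBot_of_chartedSpace (p : M) : (𝓝[≠] p).NeBot := by
  rw [Filter.neBot_iff]
  intro h
  have hopen : IsOpen ({p} : Set M) := (isOpen_singleton_iff_punctured_nhds p).2 h
  have := (chartAt ℂ p).isOpen_image_of_subset_source hopen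
    (Set.singleton_subset_iff.2 (mem_chart_source ℂ p))
  rw [Set.image_singleton] at this
  exact not_isOpen_singleton _ this

lemma tendsto_chartAt_nhdsNE (p : M) :
    Filter.Tendsto (chartAt ℂ p) (𝓝[≠] p) (𝓝[≠] (chartAt ℂ p p)) := by
  refine tendsto_nhdsWithin_iff.2 ⟨((chartAt ℂ p).continuousAt (mem_chart_source ℂ p)).tendsto.mono_left
    nhdsWithin_le_nhds, ?_⟩
  filter_upwards [self_mem_nhdsWithin, nhdsWithin_le_nhds (chart_source_mem_nhds ℂ p)] with q hq hqs
  exact fun h => hq ((chartAt ℂ p).injOn hqs (mem_chart_source ℂ p) h)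

/-- `f` is holomorphic at `q`, in the preferred chart there. -/
def HolomorphicAt (f : M → Cn n) (q : M) : Prop :=
  AnalyticAt ℂ (f ∘ (chartAt ℂ q).symm) (chartAt ℂ q q)

lemma comp_chart_symm_eventuallyEq (f : M → Cn n) {p p' q : M} (hq : q ∈ (chartAt ℂ p).source)
    (hq' : q ∈ (chartAt ℂ p').source) :
    f ∘ (chartAt ℂ p).symm =ᶠ[𝓝 (chartAt ℂ p q)]
      (f ∘ (chartAt ℂ p').symm) ∘ (chartAt ℂ p' ∘ (chartAt ℂ p).symm) := by
  have h : ∀ᶠ z in 𝓝 (chartAt ℂ p q), (chartAt ℂ p).symm z ∈ (chartAt ℂ p').source := by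
    refine ((chartAt ℂ p).symm.continuousAt ((chartAt ℂ p).map_source hq)).eventually ?_
    rw [(chartAt ℂ p).left_inv hq]
    exact (chartAt ℂ p').open_source.mem_nhds hq'
  filter_upwards [h] with z hz
  simp [(chartAt ℂ p').left_inv hz]

lemma derivAt_mem {f : M → Cn n} {q : M} {F : Submodule ℂ (Cn n)} (hf : HolomorphicAt f q)
    (hF : ∀ᶠ q' in 𝓝 q, f q' ∈ F) (d : ℕ) : derivAt d f q ∈ F := by
  have hcont : Filter.Tendsto (chartAt ℂ q).symm (𝓝 (chartAt ℂ q q)) (𝓝 q) := by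
    have := ((chartAt ℂ q).symm.continuousAt
      ((chartAt ℂ q).map_source (mem_chart_source ℂ q))).tendsto
    rwa [(chartAt ℂ q).left_inv (mem_chart_source ℂ q)] at this
  have h0 : Fᗮ.starProjection ∘ (f ∘ (chartAt ℂ q).symm) =ᶠ[𝓝 (chartAt ℂ q q)] fun _ => 0 := by
    filter_upwards [hcont.eventually hF] with z hz
    simp only [Function.comp_apply]
    rwa [Submodule.starProjection_apply_eq_zero_iff, Submodule.orthogonal_orthogonal]
  have h := h0.iteratedDeriv_eq d
  rw [iteratedDeriv_clm_comp _ hf, iteratedDeriv_fun_const_zero,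
    Submodule.starProjection_apply_eq_zero_iff, Submodule.orthogonal_orthogonal] at h
  exact h

variable [IsManifold 𝓘(ℂ) ω M]

lemma analyticAt_chart_transition {p p' q : M} (hq : q ∈ (chartAt ℂ p).source)
    (hq' : q ∈ (chartAt ℂ p').source) :
    AnalyticAt ℂ (chartAt ℂ p' ∘ (chartAt ℂ p).symm) (chartAt ℂ p q) := by
  apply ContDiffAt.analyticAt
  rw [← contMDiffAt_iff_contDiffAt]
  have h1 : ContMDiffAt 𝓘(ℂ) 𝓘(ℂ) ω (chartAt ℂ p).symm (chartAt ℂ p q) :=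
    contMDiffOn_chart_symm.contMDiffAt
      ((chartAt ℂ p).open_target.mem_nhds ((chartAt ℂ p).map_source hq))
  have h2 : ContMDiffAt 𝓘(ℂ) 𝓘(ℂ) ω (chartAt ℂ p') ((chartAt ℂ p).symm (chartAt ℂ p q)) := by
    rw [(chartAt ℂ p).left_inv hq]
    exact contMDiffOn_chart.contMDiffAt ((chartAt ℂ p').open_source.mem_nhds hq')
  exact h2.comp _ h1

lemma holomorphicAt_iff {f : M → Cn n} {p q : M} (hq : q ∈ (chartAt ℂ p).source) :
    HolomorphicAt f q ↔ AnalyticAt ℂ (f ∘ (chartAt ℂ p).symm) (chartAt ℂ p q) := by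
  have key : ∀ {p p' : M}, q ∈ (chartAt ℂ p).source → q ∈ (chartAt ℂ p').source →
      AnalyticAt ℂ (f ∘ (chartAt ℂ p').symm) (chartAt ℂ p' q) →
      AnalyticAt ℂ (f ∘ (chartAt ℂ p).symm) (chartAt ℂ p q) := by
    intro p p' hp hp' h
    refine AnalyticAt.congr ?_ (comp_chart_symm_eventuallyEq f hp hp').symm
    refine AnalyticAt.comp ?_ (analyticAt_chart_transition hp hp')
    rwa [Function.comp_apply, (chartAt ℂ p).left_inv hp]
  exact ⟨key hq (mem_chart_source ℂ q), key (mem_chart_source ℂ q) hq⟩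

lemma IsMeromorphic.eventually_holomorphicAt {f : M → Cn n} (hf : IsMeromorphic f) :
    ∀ᶠ q in Filter.codiscrete M, HolomorphicAt f q := by
  rw [eventually_codiscrete_iff]
  intro p
  filter_upwards [(tendsto_chartAt_nhdsNE p).eventually (hf p).eventually_analyticAt,
    nhdsWithin_le_nhds (chart_source_mem_nhds ℂ p)] with q hq hqs
  exact (holomorphicAt_iff hqs).2 hq

lemma eventually_forall_holomorphicAt {K : ℕ → Fin n → M → Cn n} {r : ℕ}
    (hK : ∀ m < r, ∀ j, IsMeromorphic (K m j)) :
    ∀ᶠ q in Filter.codiscrete M, ∀ m < r, ∀ j, HolomorphicAt (K m j) q := by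
  have := (Filter.eventually_all_finset (Finset.range r)).2 fun m hm =>
    Filter.eventually_all.2 fun j => (hK m (Finset.mem_range.1 hm) j).eventually_holomorphicAt
  simpa only [Finset.mem_range] using this

/-- The coefficients do not depend on f, so they serve for all rows of a column at once and give
relations between power series. -/
lemma exists_iteratedDeriv_chart_eq_sum {p p' q : M} (hq : q ∈ (chartAt ℂ p).source)
    (hq' : q ∈ (chartAt ℂ p').source) (d : ℕ) :
    ∃ c : ℕ → ℂ, ∀ f : M → Cn n, HolomorphicAt f q →
      iteratedDeriv d (f ∘ (chartAt ℂ p).symm) (chartAt ℂ p q) =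
        ∑ e ∈ Finset.range (d + 1),
          c e • iteratedDeriv e (f ∘ (chartAt ℂ p').symm) (chartAt ℂ p' q) := by
  obtain ⟨c, -, hc⟩ := exists_iteratedDeriv_comp_eq_sum (E := Cn n)
    (analyticAt_chart_transition hq hq') d
  refine ⟨fun e => c e (chartAt ℂ p q), fun f hf => ?_⟩
  have hz : (chartAt ℂ p' ∘ (chartAt ℂ p).symm) (chartAt ℂ p q) = chartAt ℂ p' q := by
    rw [Function.comp_apply, (chartAt ℂ p).left_inv hq]
  have h := (hc (f ∘ (chartAt ℂ p').symm) (by rw [hz]; exact (holomorphicAt_iff hq').1 hf))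
  rw [(comp_chart_symm_eventuallyEq f hq hq').iteratedDeriv_eq d]
  have h' := h.self_of_nhds
  rwa [hz] at h'

end Charts

/-! ### Truncated series and projections onto the next uniton -/

section Truncation

variable {n : ℕ}

/-- The first `N` coefficients of a power series. -/
def trunc (N : ℕ) : Ser n →ₗ[ℂ] (Fin N → Cn n) :=
  LinearMap.pi fun a => LinearMap.proj (a : ℕ)

/-- The polynomial with the given coefficients. -/
def ofTrunc (N : ℕ) : (Fin N → Cn n) →ₗ[ℂ] Ser n :=
  LinearMap.pi fun m => if h : m < N then LinearMap.proj (⟨m, h⟩ : Fin N) else 0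

lemma trunc_apply (N : ℕ) (u : Ser n) (a : Fin N) : trunc N u a = u a := rfl

lemma ofTrunc_apply_of_lt {N m : ℕ} (u : Fin N → Cn n) (h : m < N) :
    ofTrunc N u m = u ⟨m, h⟩ := by simp [ofTrunc, h]

lemma resid_ofTrunc_trunc (l : List (Submodule ℂ (Cn n))) (u : Ser n) :
    resid l (ofTrunc (l.length + 1) (trunc (l.length + 1) u)) = resid l u := by
  rw [← sub_eq_zero, ← map_sub]
  refine resid_of_mem_range (mem_range_shift_pow.2 fun m hm => ?_)
  rw [Pi.sub_apply, ofTrunc_apply_of_lt _ hm, trunc_apply, sub_self]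

/-- A generator λ^m L_d with d ≤ m may use every derivative of order e ≤ d. Hence W_i depends only
on the spans of the derivatives up to each order, and not on the coordinate. -/
lemma wSpace_mono {L L' : ℕ → Fin n → Ser n}
    (h : ∀ d, ∃ c : ℕ → ℂ, ∀ j, L d j = ∑ e ∈ Finset.range (d + 1), c e • L' e j) (i : ℕ) :
    wSpace L i ≤ wSpace L' i := by
  refine wSpace_le (fun j d m hdm => ?_) (range_shift_le_wSpace L' i)
  obtain ⟨c, hc⟩ := h d
  rw [hc, map_sum]
  refine sum_mem fun e he => ?_
  rw [map_smul]
  rw [Finset.mem_range] at he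
  exact Submodule.smul_mem _ _ (shift_pow_mem_wSpace L' i j (by omega))

/-- Presents W_N modulo λ^N as a span of finitely many vectors in a finite-dimensional space, as
`exists_analytic_projection` requires. -/
lemma map_trunc_wSpace (L : ℕ → Fin n → Ser n) (N : ℕ) :
    (wSpace L N).map (trunc N) = Submodule.span ℂ
      ((fun x : Fin N × Fin N × Fin n => trunc N ((shift ^ (x.2.1 : ℕ)) (L x.1 x.2.2))) ''
        (Finset.univ.filter fun x => x.1 ≤ x.2.1 : Finset (Fin N × Fin N × Fin n))) := by
  have hz {u : Ser n} (hu : u ∈ LinearMap.range (shift ^ N : Module.End ℂ (Ser n))) :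
      trunc N u = 0 := funext fun a => mem_range_shift_pow.1 hu a a.2
  apply le_antisymm
  · rw [Submodule.map_le_iff_le_comap]
    refine wSpace_le (fun j d m hdm => ?_) fun u hu => ?_
    · rw [Submodule.mem_comap]
      by_cases hm : m < N
      · exact Submodule.subset_span ⟨(⟨d, by omega⟩, ⟨m, hm⟩, j), by simpa using hdm, rfl⟩
      · rw [hz (range_shift_pow_anti (by omega : N ≤ m) ⟨_, rfl⟩)]
        exact zero_mem _
    · rw [Submodule.mem_comap, hz hu]
      exact zero_mem _
  · rw [Submodule.span_le]
    rintro _ ⟨⟨d, m, j⟩, hdm, rfl⟩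
    exact Submodule.mem_map_of_mem (shift_pow_mem_wSpace L N j (by simpa using hdm))

/-- The endomorphism of `ℂⁿ` obtained from an endomorphism of the truncated power series by
restriction to the sections of the flag `l` and evaluation of the residue. -/
def compress (l : List (Submodule ℂ (Cn n))) (N : ℕ)
    (P : (Fin N → Cn n) →L[ℂ] (Fin N → Cn n)) : Cn n →L[ℂ] Cn n :=
  LinearMap.toContinuousLinearMap
    (resid l ∘ₗ ofTrunc N ∘ₗ (P : (Fin N → Cn n) →ₗ[ℂ] (Fin N → Cn n)) ∘ₗ trunc N ∘ₗ upProd l ∘ₗ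
      constSer)

lemma compress_apply (l : List (Submodule ℂ (Cn n))) (N : ℕ)
    (P : (Fin N → Cn n) →L[ℂ] (Fin N → Cn n)) (v : Cn n) :
    compress l N P v = resid l (ofTrunc N (P (trunc N (upProd l (constSer v))))) := rfl

/-- For v in the residue space V of W_{i+1}, Φ_i v lies in W_{i+1} and has residue v. So projecting
Φ_i v to W_{i+1} and taking the residue gives a projection onto V. -/
lemma compress_isProj {L : ℕ → Fin n → Ser n} {l : List (Submodule ℂ (Cn n))}
    (h : wSpace L l.length = regSpace l) {N : ℕ} (hN : N = l.length + 1)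
    {P : (Fin N → Cn n) →L[ℂ] (Fin N → Cn n)}
    (hP : ∀ u, P u ∈ (wSpace L N).map (trunc N))
    (hP' : ∀ u ∈ (wSpace L N).map (trunc N), P u = u) :
    (∀ v, compress l N P v ∈ (wSpace L N).map (resid l)) ∧
      ∀ v ∈ (wSpace L N).map (resid l), compress l N P v = v := by
  subst hN
  refine ⟨fun v => ?_, fun v hv => ?_⟩
  · obtain ⟨w, hw, hwP⟩ := hP (trunc _ (upProd l (constSer v)))
    rw [compress_apply, ← hwP, resid_ofTrunc_trunc]
    exact Submodule.mem_map_of_mem hw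
  · have hmem : upProd l (constSer v) ∈ wSpace L (l.length + 1) := by
      rw [wSpace_eq_regSpace_cons h rfl, mem_regSpace_cons, resid_upProd, constSer_zero]
      exact ⟨upProd_mem_regSpace _ _, hv⟩
    rw [compress_apply, hP' _ (Submodule.mem_map_of_mem hmem), resid_ofTrunc_trunc, resid_upProd,
      constSer_zero]

end Truncation

/-! ### Unitons as residue spaces, and continuity of the products -/

section Continuity

variable {n : ℕ} {M : Type*} [TopologicalSpace M] [ChartedSpace ℂ M]

/-- The derivatives of order `d` of the rows `0, …, r-1` of the `j`-th column of the array `K`,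
as a power series. -/
def jet (K : ℕ → Fin n → M → Cn n) (r : ℕ) (q : M) (d : ℕ) (j : Fin n) : Ser n :=
  fun m => if m < r then derivAt d (K m j) q else 0

/-- The span of the vectors `α_{i+1,j}^{(k)}` at `q`. -/
def spanSucc (K : ℕ → Fin n → M → Cn n) (i : ℕ) (q : M) : Submodule ℂ (Cn n) :=
  Submodule.span ℂ {v | ∃ j : Fin n, ∃ k ≤ i, v = genVec K i (unitonList K i q) j k q}

lemma length_unitonList (K : ℕ → Fin n → M → Cn n) (i : ℕ) (q : M) :
    (unitonList K i q).length = i := by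
  induction i with
  | zero => rfl
  | succ i ih => rw [unitonList_succ, List.length_cons, ih]

lemma derivAt_dataH {K : ℕ → Fin n → M → Cn n} {r : ℕ} {q : M}
    (hK : ∀ m < r, ∀ j, HolomorphicAt (K m j) q) {i : ℕ} (hi : i < r) (k : ℕ) (j : Fin n) :
    derivAt k (dataH K i j) q = serH (jet K r q k j) i := by
  rw [serH]
  split_ifs with h0
  · subst h0
    rw [jet, if_pos hi]
    rfl
  · have e : dataH K i j ∘ (chartAt ℂ q).symm = fun z => ∑ s ∈ Finset.Icc 1 i,
        ((-1 : ℂ) ^ (s + i) * ((i - 1).choose (s - 1) : ℂ)) •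
          (K s j ∘ (chartAt ℂ q).symm) z := by
      funext z
      simp [dataH, h0]
    rw [derivAt, e, iteratedDeriv_fun_sum]
    · refine Finset.sum_congr rfl fun s hs => ?_
      rw [Finset.mem_Icc] at hs
      rw [iteratedDeriv_fun_const_smul_field, jet, if_pos (by omega)]
      rfl
    · intro s hs
      rw [Finset.mem_Icc] at hs
      exact ContDiffAt.const_smul _ (AnalyticAt.contDiffAt (hK s (by omega) j))

/-- By `sum_elemFun_serH` the generator is a residue with an additional factor (1 - λ)^{-(k+1)},
which the hypothesis W_i = `regSpace` allows one to drop. -/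
lemma genVec_eq_resid {K : ℕ → Fin n → M → Cn n} {r : ℕ} {q : M}
    (hK : ∀ m < r, ∀ j, HolomorphicAt (K m j) q) {i : ℕ} (hi : i < r)
    (h : wSpace (jet K r q) i = regSpace (unitonList K i q)) (j : Fin n) (k : ℕ) :
    genVec K i (unitonList K i q) j k q =
      resid (unitonList K i q) ((shift ^ k) (jet K r q k j)) := by
  have hl := length_unitonList K i q
  rw [← resid_shift_partialSums (by rw [hl, h]) (m := k + 1), ← sum_elemFun_serH, hl, genVec]
  refine Finset.sum_congr rfl fun s hs => ?_
  rw [Finset.mem_Icc] at hs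
  rw [derivAt_dataH hK (by omega)]

lemma spanSucc_eq_map_resid {K : ℕ → Fin n → M → Cn n} {r : ℕ} {q : M}
    (hK : ∀ m < r, ∀ j, HolomorphicAt (K m j) q) {i : ℕ} (hi : i < r)
    (h : wSpace (jet K r q) i = regSpace (unitonList K i q)) :
    spanSucc K i q = (wSpace (jet K r q) (i + 1)).map (resid (unitonList K i q)) := by
  have hl := length_unitonList K i q
  have := map_resid_wSpace (L := jet K r q) (l := unitonList K i q) (by rw [hl, h])
  rw [hl] at this
  rw [this, spanSucc]
  simp only [genVec_eq_resid hK hi h]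

lemma wSpace_eq_regSpace {K : ℕ → Fin n → M → Cn n} {r : ℕ} {q : M}
    (hK : ∀ m < r, ∀ j, HolomorphicAt (K m j) q) {i : ℕ} (hi : i ≤ r)
    (hreg : ∀ j < i, unitonSucc K j q = spanSucc K j q) :
    wSpace (jet K r q) i = regSpace (unitonList K i q) := by
  induction i with
  | zero => exact wSpace_zero _
  | succ i ih =>
    have hl := length_unitonList K i q
    have h := ih (by omega) fun j hj => hreg j (by omega)
    rw [unitonList_succ, hreg i (by omega), spanSucc_eq_map_resid hK (by omega) h]
    have := wSpace_eq_regSpace_cons (L := jet K r q) (l := unitonList K i q) (by rw [hl, h]) rfl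
    rwa [hl] at this

lemma continuousAt_lowProd {K : ℕ → Fin n → M → Cn n} {i : ℕ} {p : M}
    (h : ∀ j < i, ContinuousAt (fun q => (unitonSucc K j q).starProjection) p) {y : M → Ser n}
    (hy : ∀ m, ContinuousAt (fun q => y q m) p) (m : ℕ) :
    ContinuousAt (fun q => lowProd (unitonList K i q) (y q) m) p := by
  induction i generalizing m with
  | zero => exact hy m
  | succ i ih =>
    have ih' := ih fun j hj => h j (by omega)
    have hi := h i (by omega)
    simp only [unitonList_succ, lowProd, Module.End.mul_apply]
    cases m with
    | zero =>
      simp only [lowFactor_zero]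
      exact (continuousAt_starProjection_orthogonal hi).clm_apply (ih' 0)
    | succ m =>
      simp only [lowFactor_succ]
      exact (hi.clm_apply (ih' m)).add
        ((continuousAt_starProjection_orthogonal hi).clm_apply (ih' (m + 1)))

lemma continuousAt_upProd {K : ℕ → Fin n → M → Cn n} {i : ℕ} {p : M}
    (h : ∀ j < i, ContinuousAt (fun q => (unitonSucc K j q).starProjection) p) {y : M → Ser n}
    (hy : ∀ m, ContinuousAt (fun q => y q m) p) (m : ℕ) :
    ContinuousAt (fun q => upProd (unitonList K i q) (y q) m) p := by
  induction i generalizing y m with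
  | zero => exact hy m
  | succ i ih =>
    have hi := h i (by omega)
    simp only [unitonList_succ, upProd, Module.End.mul_apply]
    refine ih (fun j hj => h j (by omega)) (fun m => ?_) m
    cases m with
    | zero =>
      simp only [upFactor, LinearMap.add_apply, Pi.add_apply, Module.End.mul_apply, shift_zero,
        add_zero, onCoeff_apply]
      exact hi.clm_apply (hy 0)
    | succ m =>
      simp only [upFactor, LinearMap.add_apply, Pi.add_apply, Module.End.mul_apply, shift_succ,
        onCoeff_apply]
      exact (hi.clm_apply (hy (m + 1))).add
        ((continuousAt_starProjection_orthogonal hi).clm_apply (hy m))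

lemma continuousAt_compress {K : ℕ → Fin n → M → Cn n} {i N : ℕ} {p : M}
    (h : ∀ j < i, ContinuousAt (fun q => (unitonSucc K j q).starProjection) p)
    {P : M → (Fin N → Cn n) →L[ℂ] (Fin N → Cn n)} (hP : ContinuousAt P p) :
    ContinuousAt (fun q => compress (unitonList K i q) N (P q)) p := by
  rw [continuousAt_clm_apply]
  intro v
  simp only [compress_apply, resid_apply, length_unitonList]
  refine continuousAt_lowProd h (fun m => ?_) i
  by_cases hm : m < N
  · simp only [ofTrunc_apply_of_lt _ hm]
    have h1 : ContinuousAt (fun q => trunc N (upProd (unitonList K i q) (constSer v))) p :=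
      continuousAt_pi.2 fun a => 
        continuousAt_upProd h (y := fun _ => constSer v) (fun m => continuousAt_const) a
    exact continuousAt_pi.1 (hP.clm_apply h1) ⟨m, hm⟩
  · simp only [ofTrunc, LinearMap.pi_apply, dif_neg hm]
    exact continuousAt_const

end Continuity

/-! ### Continuity of the unitons across exceptional points -/

section Continuity

variable {n : ℕ} {M : Type*} [TopologicalSpace M] [ChartedSpace ℂ M]

/-- The derivatives of order `d` of the `j`-th column of the array `K` in the chart at `p`, at the
point with coordinate `z`, as a power series. -/
def chartJet (K : ℕ → Fin n → M → Cn n) (r : ℕ) (p : M) (z : ℂ) (d : ℕ) (j : Fin n) : Ser n :=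
  fun m => if m < r then iteratedDeriv d (K m j ∘ (chartAt ℂ p).symm) z else 0

lemma meromorphicAt_trunc_shift_chartJet {K : ℕ → Fin n → M → Cn n} {r : ℕ}
    (hK : ∀ m < r, ∀ j, IsMeromorphic (K m j)) (p : M) (N m d : ℕ) (j : Fin n) :
    MeromorphicAt (fun z => trunc N ((shift ^ m) (chartJet K r p z d j))) (chartAt ℂ p p) := by
  have key (a : Fin N) : MeromorphicAt
      (fun z => (shift ^ m) (chartJet K r p z d j) a) (chartAt ℂ p p) := by
    simp only [shift_pow_apply, chartJet]
    split_ifs with h1 h2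
    · exact MeromorphicAt.const _ _
    · rw [iteratedDeriv_eq_iterate]
      exact (hK _ h2 j p).iterated_deriv
    · exact MeromorphicAt.const _ _
  have e : (fun z => trunc N ((shift ^ m) (chartJet K r p z d j))) = fun z => ∑ a : Fin N,
      ContinuousLinearMap.single ℂ (fun _ : Fin N => Cn n) a
        ((shift ^ m) (chartJet K r p z d j) a) := by
    funext z b
    simp [trunc_apply, Finset.sum_apply, Pi.single_apply]
  rw [e]
  refine MeromorphicAt.fun_sum fun a _ => ?_
  obtain ⟨k, hk⟩ := key a
  refine ⟨k, ?_⟩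
  refine (((ContinuousLinearMap.single ℂ (fun _ : Fin N => Cn n) a).analyticAt _).comp hk).congr
    (.of_forall fun z => ?_)
  exact map_smul _ _ _

variable [IsManifold 𝓘(ℂ) ω M]

/-- The coordinate in `jet` changes with the point; near p it has to be replaced by the fixed chart
at p for the generators to become meromorphic functions. -/
lemma wSpace_jet_eq_chartJet {K : ℕ → Fin n → M → Cn n} {r : ℕ} {p q : M}
    (hK : ∀ m < r, ∀ j, HolomorphicAt (K m j) q) (hq : q ∈ (chartAt ℂ p).source) (i : ℕ) :
    wSpace (jet K r q) i = wSpace (chartJet K r p (chartAt ℂ p q)) i := by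
  apply le_antisymm
  · refine wSpace_mono (fun d => ?_) i
    obtain ⟨c, hc⟩ := exists_iteratedDeriv_chart_eq_sum (n := n) (mem_chart_source ℂ q) hq d
    refine ⟨c, fun j => funext fun m => ?_⟩
    rw [Finset.sum_apply]
    by_cases hm : m < r
    · simpa [jet, chartJet, hm, derivAt] using hc _ (hK m hm j)
    · simp [jet, chartJet, hm]
  · refine wSpace_mono (fun d => ?_) i
    obtain ⟨c, hc⟩ := exists_iteratedDeriv_chart_eq_sum (n := n) hq (mem_chart_source ℂ q) d
    refine ⟨c, fun j => funext fun m => ?_⟩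
    rw [Finset.sum_apply]
    by_cases hm : m < r
    · simpa [jet, chartJet, hm, derivAt] using hc _ (hK m hm j)
    · simp [jet, chartJet, hm]

/-- An analytic projection onto the truncated W_{i+1}, compressed through the earlier continuous
unitons, gives a continuous family A of projections whose range off p is the span of the generators.
Its range at p is then the limit space. -/
lemma unitonSucc_step [T1Space M] {K : ℕ → Fin n → M → Cn n} {r i : ℕ}
    (hK : ∀ m < r, ∀ j, IsMeromorphic (K m j)) (hi : i < r)
    (hcont : ∀ j < i, Continuous fun q => (unitonSucc K j q).starProjection)
    (hreg : ∀ᶠ q in Filter.codiscrete M, ∀ j < i, unitonSucc K j q = spanSucc K j q) :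
    (Continuous fun q => (unitonSucc K i q).starProjection) ∧
      ∀ᶠ q in Filter.codiscrete M, unitonSucc K i q = spanSucc K i q := by
  have hne := nhdsNE_neBot_of_chartedSpace (M := M)
  have hhol := eventually_forall_holomorphicAt hK
  have main (p : M) : ContinuousAt (fun q => (unitonSucc K i q).starProjection) p ∧
      ∀ᶠ q in 𝓝[≠] p, unitonSucc K i q = spanSucc K i q := by
    obtain ⟨P, hP, hPs⟩ := exists_analytic_projection
      (Finset.univ.filter fun x => x.1 ≤ x.2.1 :
        Finset (Fin (i + 1) × Fin (i + 1) × Fin n))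
      (fun x z => trunc (i + 1) ((shift ^ (x.2.1 : ℕ)) (chartJet K r p z x.1 x.2.2)))
      (chartAt ℂ p p)
      (fun x _ => meromorphicAt_trunc_shift_chartJet hK p _ _ _ _)
    set A : M → Cn n →L[ℂ] Cn n :=
      fun q => compress (unitonList K i q) (i + 1) (P (chartAt ℂ p q)) with hA
    have hAs : ∀ᶠ q in 𝓝[≠] p, (∀ v, A q v ∈ spanSucc K i q) ∧
        ∀ v ∈ spanSucc K i q, A q v = v := by
      filter_upwards [eventually_codiscrete_iff.1 hhol p, eventually_codiscrete_iff.1 hreg p,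
        (tendsto_chartAt_nhdsNE p).eventually hPs,
        nhdsWithin_le_nhds (chart_source_mem_nhds ℂ p)] with q h1 h2 h3 h4
      have hw := wSpace_eq_regSpace h1 hi.le h2
      rw [spanSucc_eq_map_resid h1 hi hw]
      have hl := length_unitonList K i q
      rw [← map_trunc_wSpace, ← wSpace_jet_eq_chartJet h1 h4] at h3
      exact compress_isProj (by rw [hl, hw]) (by rw [hl]) h3.1 h3.2
    have hAc : ∀ᶠ q in 𝓝 p, ContinuousAt A q := by
      have h1 : ContinuousAt (chartAt ℂ p) p :=
        (chartAt ℂ p).continuousAt (mem_chart_source ℂ p)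
      filter_upwards [h1.eventually hP.eventually_analyticAt,
        chart_source_mem_nhds ℂ p] with q h2 h3
      refine continuousAt_compress (fun j hj => (hcont j hj).continuousAt) ?_
      exact ContinuousAt.comp (f := chartAt ℂ p) h2.continuousAt ((chartAt ℂ p).continuousAt h3)
    -- The fibre at a nearby q is also defined as a limit, so the property of A is needed on a
    -- punctured neighbourhood of q to identify that fibre with the span.
    have hA1 : ∀ᶠ q in 𝓝[≠] p, ∀ᶠ q' in 𝓝[≠] q, (∀ v, A q' v ∈ spanSucc K i q') ∧
        ∀ v ∈ spanSucc K i q', A q' v = v := by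
      have := eventually_eventually_nhdsWithin.2 hAs
      filter_upwards [this, self_mem_nhdsWithin] with q hq hqp
      rw [IsOpen.nhdsWithin_eq isOpen_compl_singleton hqp] at hq
      exact nhdsWithin_le_nhds hq
    have hAp := limitSpace_eq_range hAc.self_of_nhds hAs
    have hAq : ∀ᶠ q in 𝓝[≠] p, (∀ v, A q v ∈ unitonSucc K i q) ∧
        ∀ v ∈ unitonSucc K i q, A q v = v := by
      filter_upwards [nhdsWithin_le_nhds hAc, hA1] with q h1 h2
      exact limitSpace_eq_range h1 h2
    refine ⟨continuousAt_starProjection hAc.self_of_nhds ?_, ?_⟩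
    · rw [eventually_nhdsWithin_iff] at hAq
      filter_upwards [hAq] with q hq
      by_cases e : q = p
      · rw [e]; exact hAp
      · exact hq e
    · filter_upwards [hAs, hAq] with q h1 h2
      refine le_antisymm (fun v hv => ?_) fun v hv => ?_
      · rw [← h2.2 v hv]; exact h1.1 v
      · rw [← h1.2 v hv]; exact h2.1 v
  exact ⟨continuous_iff_continuousAt.2 fun p => (main p).1,
    eventually_codiscrete_iff.2 fun p => (main p).2⟩

lemma unitonSucc_regular [T1Space M] {K : ℕ → Fin n → M → Cn n} {r : ℕ}
    (hK : ∀ m < r, ∀ j, IsMeromorphic (K m j)) :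
    (∀ i < r, Continuous fun q => (unitonSucc K i q).starProjection) ∧
      ∀ᶠ q in Filter.codiscrete M, ∀ i < r, unitonSucc K i q = spanSucc K i q := by
  have key (N : ℕ) (hN : N ≤ r) : (∀ i < N, Continuous fun q => (unitonSucc K i q).starProjection) ∧
      ∀ᶠ q in Filter.codiscrete M, ∀ i < N, unitonSucc K i q = spanSucc K i q := by
    induction N with
    | zero => exact ⟨fun i hi => absurd hi (Nat.not_lt_zero i), by simp⟩
    | succ N ih =>
      obtain ⟨h1, h2⟩ := ih (by omega)
      obtain ⟨h3, h4⟩ := unitonSucc_step hK (by omega : N < r) h1 h2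
      refine ⟨fun i hi => ?_, ?_⟩
      · rcases Nat.lt_succ_iff_lt_or_eq.1 hi with h | rfl
        exacts [h1 i h, h3]
      · filter_upwards [h2, h4] with q h5 h6 i hi
        rcases Nat.lt_succ_iff_lt_or_eq.1 hi with h | rfl
        exacts [h5 i h, h6]
  exact key r le_rfl

end Continuity

/-! ### Self-adjoint involutions and dimensions of eigenspaces -/

section Involutions

variable {n : ℕ}

/-- The eigenspace of an endomorphism of `ℂⁿ`. -/
abbrev eig (φ : Cn n →L[ℂ] Cn n) (ε : ℂ) : Submodule ℂ (Cn n) :=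
  Module.End.eigenspace (φ : Cn n →ₗ[ℂ] Cn n) ε

lemma mem_eig {φ : Cn n →L[ℂ] Cn n} {ε : ℂ} {v : Cn n} : v ∈ eig φ ε ↔ φ v = ε • v :=
  Module.End.mem_eigenspace_iff

lemma cartan_apply (V : Submodule ℂ (Cn n)) (v : Cn n) :
    cartan V v = (2 : ℂ) • V.starProjection v - v := by
  rw [cartan, Submodule.starProjection_orthogonal', two_smul]
  change V.starProjection v - (v - V.starProjection v) = _
  abel

lemma isSelfAdjoint_cartan (V : Submodule ℂ (Cn n)) : IsSelfAdjoint (cartan V) :=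
  (isSelfAdjoint_starProjection V).sub (isSelfAdjoint_starProjection Vᗮ)

lemma cartan_mul_self (V : Submodule ℂ (Cn n)) : cartan V * cartan V = 1 := by
  rw [cartan, sub_mul, mul_sub, mul_sub, proj_mul_self, proj_mul_perp, perp_mul_proj,
    proj_mul_self, sub_zero, zero_sub, sub_neg_eq_add, proj_add_perp]

lemma eig_cartan (V : Submodule ℂ (Cn n)) : eig (cartan V) 1 = V := by
  ext v
  rw [mem_eig, cartan_apply, one_smul, sub_eq_iff_eq_add, ← two_smul ℂ v,
    (smul_right_injective (Cn n) (two_ne_zero (α := ℂ))).eq_iff,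
    Submodule.starProjection_eq_self_iff]

lemma proj_mul_cartan (V : Submodule ℂ (Cn n)) :
    V.starProjection * cartan V = V.starProjection := by
  rw [cartan, mul_sub, proj_mul_self, proj_mul_perp, sub_zero]

lemma starProjection_eig {φ : Cn n →L[ℂ] Cn n} (hsa : IsSelfAdjoint φ) (hinv : φ * φ = 1)
    (v : Cn n) : (eig φ 1).starProjection v = (2⁻¹ : ℂ) • (v + φ v) := by
  have hφ (w : Cn n) : φ (φ w) = w := DFunLike.congr_fun hinv w
  refine Submodule.eq_starProjection_of_mem_orthogonal (K := eig φ 1) ?_ ?_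
  · rw [mem_eig, one_smul, map_smul, map_add, hφ, add_comm]
  · have e : v - (2⁻¹ : ℂ) • (v + φ v) = (2⁻¹ : ℂ) • (v - φ v) := by module
    rw [e]
    refine Submodule.smul_mem _ _ ?_
    rw [Submodule.mem_orthogonal]
    intro u hu
    rw [mem_eig, one_smul] at hu
    have h : inner ℂ (φ u) v = inner ℂ u (φ v) := hsa.isSymmetric u v
    rw [inner_sub_right, ← h, hu, sub_self]

lemma eq_cartan_eig {φ : Cn n →L[ℂ] Cn n} (hsa : IsSelfAdjoint φ) (hinv : φ * φ = 1) :
    φ = cartan (eig φ 1) := by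
  ext1 v
  rw [cartan_apply, starProjection_eig hsa hinv]
  module

lemma trace_eq_finrank_eig {φ : Cn n →L[ℂ] Cn n} (hsa : IsSelfAdjoint φ) (hinv : φ * φ = 1) :
    LinearMap.trace ℂ (Cn n) (φ : Cn n →ₗ[ℂ] Cn n) =
      2 * (Module.finrank ℂ (eig φ 1) : ℂ) - n := by
  have hproj : LinearMap.IsProj (eig φ 1)
      ((eig φ 1).starProjection : Cn n →ₗ[ℂ] Cn n) :=
    ⟨fun v => (eig φ 1).starProjection_apply_mem v,
      fun v hv => Submodule.starProjection_eq_self_iff.2 hv⟩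
  have h1 := hproj.trace
  have h2 : (φ : Cn n →ₗ[ℂ] Cn n) =
      (2 : ℂ) • ((eig φ 1).starProjection : Cn n →ₗ[ℂ] Cn n) - 1 := by
    ext1 v
    change φ v = (2 : ℂ) • (eig φ 1).starProjection v - v
    rw [starProjection_eig hsa hinv]
    module
  rw [h2, map_sub, map_smul, h1, LinearMap.trace_one]
  simp

/-- Invariance reads πφπ = φπ; its adjoint is πφπ = πφ. -/
lemma commute_starProjection {φ : Cn n →L[ℂ] Cn n} (hsa : IsSelfAdjoint φ)
    {V : Submodule ℂ (Cn n)} (hV : ∀ v ∈ V, φ v ∈ V) : Commute φ V.starProjection := by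
  have h1 : V.starProjection * (φ * V.starProjection) = φ * V.starProjection := by
    ext1 v
    exact Submodule.starProjection_eq_self_iff.2 (hV _ (V.starProjection_apply_mem v))
  have h2 := congrArg star h1
  rw [star_mul, star_mul, hsa.star_eq, (isSelfAdjoint_starProjection V).star_eq] at h2
  rw [Commute, SemiconjBy, ← h1, ← mul_assoc, h2]

lemma finrank_eq_add_finrank_inf_eig {c : Cn n →L[ℂ] Cn n} (hinv : c * c = 1)
    {V : Submodule ℂ (Cn n)} (hV : ∀ v ∈ V, c v ∈ V) :
    Module.finrank ℂ V = Module.finrank ℂ ↥(V ⊓ eig c 1) + Module.finrank ℂ ↥(V ⊓ eig c (-1)) := by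
  have hc (w : Cn n) : c (c w) = w := DFunLike.congr_fun hinv w
  have h1 : (V ⊓ eig c 1) ⊔ (V ⊓ eig c (-1)) = V := by
    refine le_antisymm (sup_le inf_le_left inf_le_left) fun v hv => ?_
    have e : v = (2⁻¹ : ℂ) • (v + c v) + (2⁻¹ : ℂ) • (v - c v) := by module
    rw [e]
    refine Submodule.add_mem_sup ⟨V.smul_mem _ (V.add_mem hv (hV v hv)), ?_⟩
      ⟨V.smul_mem _ (V.sub_mem hv (hV v hv)), ?_⟩
    · change _ ∈ eig c 1
      rw [mem_eig, map_smul, map_add, hc]; module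
    · change _ ∈ eig c (-1)
      rw [mem_eig, map_smul, map_sub, hc]; module
  have h2 : (V ⊓ eig c 1) ⊓ (V ⊓ eig c (-1)) = ⊥ := by
    rw [eq_bot_iff]
    rintro v ⟨⟨-, h⟩, -, h'⟩
    have h : c v = (1 : ℂ) • v := mem_eig.1 h
    have h' : c v = (-1 : ℂ) • v := mem_eig.1 h'
    rw [h, one_smul, neg_one_smul] at h'
    have h2 : (2 : ℂ) • v = 0 := by rw [two_smul]; exact add_eq_zero_iff_eq_neg.2 h'
    exact (smul_eq_zero.1 h2).resolve_left two_ne_zero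
  have := Submodule.finrank_sup_add_finrank_inf_eq (V ⊓ eig c 1) (V ⊓ eig c (-1))
  rwa [h1, h2, finrank_bot, add_zero] at this

/-- On V the product agrees with φ and on V^⊥ with -φ. So its (+1)-eigenspace is the sum of V ∩ E_+
and V^⊥ ∩ E_-, where E_± are the eigenspaces of φ, and dim(V^⊥ ∩ E_-) = n - dim E_+ - dim(V ∩ E_-).
-/
lemma finrank_eig_mul_cartan {φ : Cn n →L[ℂ] Cn n} (hinv : φ * φ = 1)
    {V : Submodule ℂ (Cn n)} (hV : Commute φ (cartan V)) :
    Module.finrank ℂ (eig (φ * cartan V) 1) + Module.finrank ℂ (eig φ 1) +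
      Module.finrank ℂ ↥(V ⊓ eig φ (-1)) = n + Module.finrank ℂ ↥(V ⊓ eig φ 1) := by
  set c := cartan V with hc
  have hcinv : c * c = 1 := cartan_mul_self V
  have hcV : eig c 1 = V := eig_cartan V
  have hcφ (v : Cn n) : c (φ v) = φ (c v) := DFunLike.congr_fun hV.eq.symm v
  have h1 := finrank_eq_add_finrank_inf_eig hinv (V := ⊤) fun _ _ => trivial
  rw [finrank_top, finrank_euclideanSpace_fin, top_inf_eq, top_inf_eq] at h1
  have h2 := finrank_eq_add_finrank_inf_eig hcinv (V := eig φ (-1)) fun v hv => by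
    rw [mem_eig] at *; rw [← hcφ, hv, map_smul]
  have h3 := finrank_eq_add_finrank_inf_eig hcinv (V := eig (φ * c) 1) fun v hv => by
    rw [mem_eig] at *
    change φ (c (c v)) = _
    rw [← hcφ]
    change φ (c v) = _ at hv
    rw [hv, map_smul]
  have e1 : eig (φ * c) 1 ⊓ eig c 1 = V ⊓ eig φ 1 := by
    rw [inf_comm, hcV]
    ext v
    simp only [Submodule.mem_inf]
    refine and_congr_right fun hv => ?_
    rw [← hcV, mem_eig, one_smul] at hv
    rw [mem_eig, mem_eig]
    change φ (c v) = _ ↔ _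
    rw [hv]
  have e2 : eig (φ * c) 1 ⊓ eig c (-1) = eig φ (-1) ⊓ eig c (-1) := by
    ext v
    simp only [Submodule.mem_inf]
    refine and_congr_left fun hv => ?_
    rw [mem_eig] at hv
    rw [mem_eig, mem_eig]
    change φ (c v) = _ ↔ _
    rw [hv, map_smul, neg_one_smul, neg_one_smul, one_smul, neg_eq_iff_eq_neg]
  rw [e1, e2] at h3
  rw [hcV, inf_comm _ V] at h2
  omega

lemma finrank_add_le_of_le_map {U T N : Submodule ℂ (Cn n)} (f : Cn n →ₗ[ℂ] Cn n)
    (hT : T ≤ U.map f) (hN : N ≤ U) (hN' : ∀ v ∈ N, f v = 0) :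
    Module.finrank ℂ T + Module.finrank ℂ N ≤ Module.finrank ℂ U := by
  have h := (f.domRestrict U).finrank_range_add_finrank_ker
  rw [LinearMap.range_domRestrict] at h
  have h1 := Submodule.finrank_mono hT
  have h2 : Module.finrank ℂ N ≤ Module.finrank ℂ (LinearMap.ker (f.domRestrict U)) := by
    have : N ≤ (LinearMap.ker (f.domRestrict U)).map U.subtype := fun v hv =>
      ⟨⟨v, hN hv⟩, hN' v hv, rfl⟩
    refine (Submodule.finrank_mono this).trans ?_
    exact Submodule.finrank_map_le _ _
  omega

end Involutions

/-! ### The symmetry u(λ) ↦ φ u(-λ) -/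

section Twist

variable {n : ℕ}

/-- The map `u(λ) ↦ φ u(-λ)` of power series. -/
def twist (φ : Cn n →L[ℂ] Cn n) : Module.End ℂ (Ser n) where
  toFun u m := (-1 : ℂ) ^ m • φ (u m)
  map_add' u v := by ext1 m; simp
  map_smul' c u := by ext1 m; simp [smul_comm c]

lemma twist_apply (φ : Cn n →L[ℂ] Cn n) (u : Ser n) (m : ℕ) :
    twist φ u m = (-1 : ℂ) ^ m • φ (u m) := rfl

lemma twist_shift (φ : Cn n →L[ℂ] Cn n) (u : Ser n) :
    twist φ (shift u) = -shift (twist φ u) := by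
  ext1 m
  cases m with
  | zero => simp [twist_apply]
  | succ m => simp [twist_apply, pow_succ]

lemma twist_shift_pow (φ : Cn n →L[ℂ] Cn n) (k : ℕ) (u : Ser n) :
    twist φ ((shift ^ k) u) = (-1 : ℂ) ^ k • (shift ^ k) (twist φ u) := by
  induction k with
  | zero => simp
  | succ k ih =>
    rw [pow_succ', Module.End.mul_apply, twist_shift, ih, map_smul, pow_succ', mul_smul,
      neg_one_smul]
    rfl

/-- Replacing λ by -λ turns λπ + π^⊥ into -λπ + π^⊥ = -(λπ + π^⊥)(π - π^⊥). -/
lemma lowFactor_twist {φ : Cn n →L[ℂ] Cn n} {V : Submodule ℂ (Cn n)}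
    (h : Commute φ V.starProjection) (u : Ser n) :
    lowFactor V (twist φ u) = -twist (φ * cartan V) (lowFactor V u) := by
  have h' : Commute φ Vᗮ.starProjection := by
    rw [Submodule.starProjection_orthogonal']
    exact (Commute.one_right _).sub_right h
  have e1 (w : Cn n) : V.starProjection (φ w) = φ (V.starProjection w) :=
    DFunLike.congr_fun h.eq.symm w
  have e2 (w : Cn n) : Vᗮ.starProjection (φ w) = φ (Vᗮ.starProjection w) :=
    DFunLike.congr_fun h'.eq.symm w
  have e3 (w : Cn n) : (φ * cartan V) (V.starProjection w) = φ (V.starProjection w) := by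
    change φ (cartan V (V.starProjection w)) = _
    rw [cartan_apply, Submodule.starProjection_eq_self_iff.2 (V.starProjection_apply_mem w)]
    congr 1
    module
  have e4 (w : Cn n) : (φ * cartan V) (Vᗮ.starProjection w) = -φ (Vᗮ.starProjection w) := by
    change φ (cartan V (Vᗮ.starProjection w)) = _
    have : V.starProjection (Vᗮ.starProjection w) = 0 := DFunLike.congr_fun (proj_mul_perp V) w
    rw [cartan_apply, this, smul_zero, zero_sub, map_neg]
  ext1 m
  cases m with
  | zero =>
    rw [lowFactor_zero, Pi.neg_apply, twist_apply, twist_apply, lowFactor_zero, e4, map_smul, e2]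
    simp
  | succ m =>
    rw [lowFactor_succ, Pi.neg_apply, twist_apply, twist_apply, twist_apply, lowFactor_succ,
      map_add, e3, e4, map_smul, map_smul, e1, e2, pow_succ]
    module

lemma twist_mem_wSpace {φ : Cn n →L[ℂ] Cn n} {L : ℕ → Fin n → Ser n}
    (h : ∀ d j, twist φ (L d j) = L d j ∨ twist φ (L d j) = -L d j) {i : ℕ} {u : Ser n}
    (hu : u ∈ wSpace L i) : twist φ u ∈ wSpace L i := by
  have : wSpace L i ≤ (wSpace L i).comap (twist φ) := by
    refine wSpace_le (fun j d m hdm => ?_) ?_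
    · have hmem := shift_pow_mem_wSpace L i j hdm
      rw [Submodule.mem_comap, twist_shift_pow]
      refine Submodule.smul_mem _ _ ?_
      rcases h d j with h | h <;> rw [h]
      · exact hmem
      · rw [map_neg]; exact neg_mem hmem
    · rintro _ ⟨v, rfl⟩
      rw [Submodule.mem_comap, twist_shift_pow]
      exact Submodule.smul_mem _ _ (range_shift_le_wSpace L i ⟨_, rfl⟩)
  exact this hu

lemma lowProd_apply_zero (l : List (Submodule ℂ (Cn n))) (u : Ser n) :
    lowProd l u 0 = elemFun l.length l (u 0) := by
  induction l with
  | nil => simp [lowProd, elemFun_zero]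
  | cons V l ih =>
    rw [List.length_cons, elemFun_succ_cons, elemFun_of_length_lt (Nat.lt_succ_self _), zero_add]
    change lowFactor V (lowProd l u) 0 = Vᗮ.starProjection (elemFun l.length l (u 0))
    rw [lowFactor_zero, ih]

lemma resid_shift_pow_length (l : List (Submodule ℂ (Cn n))) (u : Ser n) :
    resid l ((shift ^ l.length) u) = elemFun l.length l (u 0) := by
  rw [resid_apply, lowProd_shift_pow, shift_pow_apply, if_neg (lt_irrefl _), Nat.sub_self,
    lowProd_apply_zero]

/-- The coefficient of order i + 1 of (λπ_V + π_V^⊥)y has the V-component of y_i. This links the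
residues for consecutive unitons. -/
lemma proj_resid_cons (V : Submodule ℂ (Cn n)) (l : List (Submodule ℂ (Cn n))) (u : Ser n) :
    V.starProjection (resid (V :: l) u) = V.starProjection (resid l u) := by
  change V.starProjection (lowFactor V (lowProd l u) (l.length + 1)) = _
  have e1 : V.starProjection (V.starProjection (lowProd l u l.length)) =
    V.starProjection (lowProd l u l.length) := DFunLike.congr_fun (proj_mul_self V) _
  have e2 : V.starProjection (Vᗮ.starProjection (lowProd l u (l.length + 1))) = 0 :=
    DFunLike.congr_fun (proj_mul_perp V) _
  rw [lowFactor_succ, map_add, e1, e2, add_zero, resid_apply]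

end Twist

/-! ### Regular and generic points: symmetry, lifting and dimension count -/

section RegularPoints

variable {n : ℕ} {M : Type*} [TopologicalSpace M] [ChartedSpace ℂ M]

/-- The point `q` is regular for the `F₀`-array `K`: the first `r` rows are holomorphic at `q`, the
columns alternate between `F₀` and `F₀ᗮ`, and the fibres at `q` of the unitons are spanned by the
given sections. -/
structure IsRegularPoint (F₀ : Submodule ℂ (Cn n)) (r : ℕ) (K : ℕ → Fin n → M → Cn n) (q : M) :
    Prop where
  holomorphic : ∀ m < r, ∀ j, HolomorphicAt (K m j) q
  alternating : ∀ d j, twist (cartan F₀) (jet K r q d j) = jet K r q d j ∨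
    twist (cartan F₀) (jet K r q d j) = -jet K r q d j
  spanned : ∀ i < r, unitonSucc K i q = spanSucc K i q

lemma cartan_apply_of_mem {V : Submodule ℂ (Cn n)} {v : Cn n} (hv : v ∈ V) : cartan V v = v := by
  rw [cartan_apply, Submodule.starProjection_eq_self_iff.2 hv, two_smul, add_sub_cancel_right]

lemma cartan_apply_of_mem_orthogonal {V : Submodule ℂ (Cn n)} {v : Cn n} (hv : v ∈ Vᗮ) :
    cartan V v = -v := by
  rw [cartan_apply, (Submodule.starProjection_apply_eq_zero_iff V).2 hv, smul_zero, zero_sub]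

lemma IsF0Array.eventually_isRegularPoint [IsManifold 𝓘(ℂ) ω M] [T1Space M]
    {F₀ : Submodule ℂ (Cn n)} {r : ℕ} {K : ℕ → Fin n → M → Cn n} (hK : IsF0Array F₀ r K) :
    ∀ᶠ q in Filter.codiscrete M, IsRegularPoint F₀ r K q := by
  have hhol := eventually_forall_holomorphicAt hK.meromorphic
  have hval : ∀ᶠ q in Filter.codiscrete M, ∀ j,
      (∀ m ∈ Finset.range r, ∀ᶠ q' in 𝓝 q,
        (Even m → K m j q' ∈ F₀) ∧ (Odd m → K m j q' ∈ F₀ᗮ)) ∨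
      (∀ m ∈ Finset.range r, ∀ᶠ q' in 𝓝 q,
        (Even m → K m j q' ∈ F₀ᗮ) ∧ (Odd m → K m j q' ∈ F₀)) := by
    rw [Filter.eventually_all]
    intro j
    rcases hK.alternating j with h | h
    · refine Filter.Eventually.mono ((Filter.eventually_all_finset _).2 fun m hm =>
        eventually_codiscrete_nhds ?_) fun q hq => Or.inl hq
      exact (Filter.eventually_imp_distrib_left.2 (h m (Finset.mem_range.1 hm)).1).and
        (Filter.eventually_imp_distrib_left.2 (h m (Finset.mem_range.1 hm)).2)
    · refine Filter.Eventually.mono ((Filter.eventually_all_finset _).2 fun m hm =>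
        eventually_codiscrete_nhds ?_) fun q hq => Or.inr hq
      exact (Filter.eventually_imp_distrib_left.2 (h m (Finset.mem_range.1 hm)).1).and
        (Filter.eventually_imp_distrib_left.2 (h m (Finset.mem_range.1 hm)).2)
  filter_upwards [hhol, hval, (unitonSucc_regular hK.meromorphic).2] with q h1 h2 h3
  refine ⟨h1, fun d j => ?_, h3⟩
  rcases h2 j with h | h
  · refine Or.inl (funext fun m => ?_)
    rw [twist_apply, jet]
    split_ifs with hm
    · have hm' := h m (Finset.mem_range.2 hm)
      rcases Nat.even_or_odd m with he | ho
      · rw [cartan_apply_of_mem (derivAt_mem (h1 m hm j) (hm'.mono fun _ h => h.1 he) d),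
          he.neg_one_pow, one_smul]
      · rw [cartan_apply_of_mem_orthogonal
          (derivAt_mem (h1 m hm j) (hm'.mono fun _ h => h.2 ho) d), ho.neg_one_pow, neg_one_smul,
          neg_neg]
    · simp
  · refine Or.inr (funext fun m => ?_)
    rw [twist_apply, Pi.neg_apply, jet]
    split_ifs with hm
    · have hm' := h m (Finset.mem_range.2 hm)
      rcases Nat.even_or_odd m with he | ho
      · rw [cartan_apply_of_mem_orthogonal
          (derivAt_mem (h1 m hm j) (hm'.mono fun _ h => h.1 he) d), he.neg_one_pow, one_smul]
      · rw [cartan_apply_of_mem (derivAt_mem (h1 m hm j) (hm'.mono fun _ h => h.2 ho) d),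
          ho.neg_one_pow, neg_one_smul]
    · simp

namespace IsRegularPoint

variable {F₀ : Submodule ℂ (Cn n)} {r : ℕ} {K : ℕ → Fin n → M → Cn n} {q : M}

lemma wSpace_eq (h : IsRegularPoint F₀ r K q) {i : ℕ} (hi : i ≤ r) :
    wSpace (jet K r q) i = regSpace (unitonList K i q) :=
  wSpace_eq_regSpace h.holomorphic hi fun j hj => h.spanned j (by omega)

lemma unitonSucc_eq (h : IsRegularPoint F₀ r K q) {i : ℕ} (hi : i < r) :
    unitonSucc K i q = (wSpace (jet K r q) (i + 1)).map (resid (unitonList K i q)) := by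
  rw [h.spanned i hi, spanSucc_eq_map_resid h.holomorphic hi (h.wSpace_eq hi.le)]

/-- The twist by F_0 preserves W_{i+1}, and passing it through one more factor multiplies φ_i by π -
π^⊥. The factor can be passed because φ_i preserves the next uniton, so all four properties are
proved in one induction. -/
lemma partialMap_spec (h : IsRegularPoint F₀ r K q) {i : ℕ} (hi : i ≤ r) :
    IsSelfAdjoint (partialMap F₀ K i q) ∧ partialMap F₀ K i q * partialMap F₀ K i q = 1 ∧
      (∀ u, lowProd (unitonList K i q) (twist (cartan F₀) u) =
        (-1 : ℂ) ^ i • twist (partialMap F₀ K i q) (lowProd (unitonList K i q) u)) ∧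
      (i < r → ∀ v ∈ unitonSucc K i q, partialMap F₀ K i q v ∈ unitonSucc K i q) := by
  -- The residue is the coefficient of order i, where the twist contributes (-1)^i; this cancels the
  -- sign in `hsym`.
  have inv (i : ℕ) (hsym : ∀ u, lowProd (unitonList K i q) (twist (cartan F₀) u) =
        (-1 : ℂ) ^ i • twist (partialMap F₀ K i q) (lowProd (unitonList K i q) u)) (hi : i < r) :
      ∀ v ∈ unitonSucc K i q, partialMap F₀ K i q v ∈ unitonSucc K i q := by
    rw [h.unitonSucc_eq hi]
    rintro _ ⟨w, hw, rfl⟩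
    refine ⟨twist (cartan F₀) w, twist_mem_wSpace h.alternating hw, ?_⟩
    rw [resid_apply, hsym, length_unitonList, Pi.smul_apply, twist_apply, smul_smul,
      ← mul_pow, neg_one_mul, neg_neg, one_pow, one_smul, resid_apply, length_unitonList]
  induction i with
  | zero =>
    have hsym (u : Ser n) : lowProd (unitonList K 0 q) (twist (cartan F₀) u) =
        (-1 : ℂ) ^ 0 • twist (partialMap F₀ K 0 q) (lowProd (unitonList K 0 q) u) := by
      rw [pow_zero, one_smul]; rfl
    exact ⟨isSelfAdjoint_cartan F₀, cartan_mul_self F₀, hsym, inv 0 hsym⟩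
  | succ i ih =>
    obtain ⟨hsa, hinv, hsym, hV⟩ := ih (by omega)
    have hc := commute_starProjection hsa (hV (by omega))
    have hc' : Commute (partialMap F₀ K i q) (cartan (unitonSucc K i q)) := by
      rw [cartan, Submodule.starProjection_orthogonal']
      exact hc.sub_right ((Commute.one_right _).sub_right hc)
    have hsym' (u : Ser n) : lowProd (unitonList K (i + 1) q) (twist (cartan F₀) u) =
        (-1 : ℂ) ^ (i + 1) •
          twist (partialMap F₀ K (i + 1) q) (lowProd (unitonList K (i + 1) q) u) := by
      rw [unitonList_succ, lowProd, Module.End.mul_apply, hsym, map_smul, lowFactor_twist hc,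
        pow_succ, mul_smul, neg_one_smul]
      rfl
    refine ⟨?_, ?_, hsym', inv _ hsym'⟩
    · exact (IsSelfAdjoint.commute_iff hsa (isSelfAdjoint_cartan _)).1 hc'
    · change partialMap F₀ K i q * cartan _ * (partialMap F₀ K i q * cartan _) = 1
      rw [mul_assoc, ← mul_assoc (cartan _), ← hc'.eq, mul_assoc, ← mul_assoc, hinv, one_mul,
        cartan_mul_self]

lemma partialMap_resid (h : IsRegularPoint F₀ r K q) {i : ℕ} (hi : i ≤ r) (u : Ser n) :
    partialMap F₀ K i q (resid (unitonList K i q) u) =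
      resid (unitonList K i q) (twist (cartan F₀) u) := by
  rw [resid_apply, resid_apply, (h.partialMap_spec hi).2.2.1, length_unitonList, Pi.smul_apply,
    twist_apply, smul_smul, ← mul_pow, neg_one_mul, neg_neg, one_pow, one_smul]

lemma commute_partialMap (h : IsRegularPoint F₀ r K q) {i : ℕ} (hi : i < r) :
    Commute (partialMap F₀ K i q) (unitonSucc K i q).starProjection :=
  commute_starProjection (h.partialMap_spec hi.le).1 ((h.partialMap_spec hi.le).2.2.2 hi)

lemma proj_partialMap_succ (h : IsRegularPoint F₀ r K q) {i : ℕ} (hi : i < r) (v : Cn n) :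
    (unitonSucc K i q).starProjection (partialMap F₀ K (i + 1) q v) =
      partialMap F₀ K i q ((unitonSucc K i q).starProjection v) := by
  have e : (unitonSucc K i q).starProjection * (partialMap F₀ K i q * cartan (unitonSucc K i q)) =
      partialMap F₀ K i q * (unitonSucc K i q).starProjection := by
    rw [← mul_assoc, ← (h.commute_partialMap hi).eq, mul_assoc, proj_mul_cartan]
  exact DFunLike.congr_fun e v

/-- A vector v = resid w of one uniton lifts to the residue of the same w one step later, which has
the projection v; averaging the lift over the involution makes it an eigenvector. -/
lemma le_map_proj (h : IsRegularPoint F₀ r K q) {i : ℕ} (hi : i + 1 < r) {ε : ℂ}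
    (hε : ε * ε = 1) :
    unitonSucc K i q ⊓ eig (partialMap F₀ K i q) ε ≤
      (unitonSucc K (i + 1) q ⊓ eig (partialMap F₀ K (i + 1) q) ε).map
        ((unitonSucc K i q).starProjection : Cn n →ₗ[ℂ] Cn n) := by
  rintro v ⟨hv, hvε⟩
  have hvε : partialMap F₀ K i q v = ε • v := mem_eig.1 hvε
  have hv' := hv
  rw [SetLike.mem_coe, h.unitonSucc_eq (by omega)] at hv'
  obtain ⟨w, hw, hwv⟩ := hv'
  -- The component of w divisible by λ^{i+1} has no residue. Discarding it leaves a combination of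
  -- the generators λ^m L_d, which belong to every W.
  obtain ⟨w, hw', hwv⟩ : ∃ w' ∈ wSpace (jet K r q) (i + 1 + 1),
      resid (unitonList K i q) w' = v := by
    obtain ⟨x, hx, y, hy, rfl⟩ := Submodule.mem_sup.1 hw
    refine ⟨x, Submodule.mem_sup_left hx, ?_⟩
    rw [map_add, resid_of_mem_range (u := y) (by rwa [length_unitonList]), add_zero] at hwv
    exact hwv
  set φ := partialMap F₀ K (i + 1) q
  obtain ⟨-, hinv, -, hV⟩ := h.partialMap_spec hi.le
  have hφ (x : Cn n) : φ (φ x) = x := DFunLike.congr_fun hinv x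
  set v' := resid (unitonList K (i + 1) q) w with hv'
  have hv'mem : v' ∈ unitonSucc K (i + 1) q := by
    rw [h.unitonSucc_eq hi]
    exact Submodule.mem_map_of_mem hw'
  have hproj : (unitonSucc K i q).starProjection v' = v := by
    rw [hv', unitonList_succ, proj_resid_cons, hwv]
    exact Submodule.starProjection_eq_self_iff.2 hv
  refine ⟨(2⁻¹ : ℂ) • (v' + ε • φ v'), ⟨?_, ?_⟩, ?_⟩
  · exact Submodule.smul_mem _ _ (add_mem hv'mem (Submodule.smul_mem _ _ (hV hi _ hv'mem)))
  · change _ ∈ eig φ ε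
    have e : ε • (v' + ε • φ v') = ε • v' + φ v' := by rw [smul_add, smul_smul, hε, one_smul]
    rw [mem_eig, map_smul, map_add, map_smul, hφ, smul_comm ε, e, add_comm]
  · change (unitonSucc K i q).starProjection _ = v
    rw [map_smul, map_add, map_smul, h.proj_partialMap_succ (by omega), hproj, hvε, smul_smul, hε]
    module

/-- If the rows above a vanish, the column is divisible by λ^a, and λ^{i-a} times its derivative of
order i - a is λ^i u with u_0 = K_{a,c}^{(i-a)}. The residue of λ^i u is C^i_i u_0, and the twist of
λ^i brings in the sign (-1)^i. -/
lemma topVec_mem (h : IsRegularPoint F₀ r K q) {i a : ℕ} (hi : i < r) (ha : a ≤ i) {c : Fin n}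
    (hvan : ∀ m < a, ∀ d, derivAt d (K m c) q = 0) {ε : ℂ}
    (hε : ∀ d, cartan F₀ (derivAt d (K a c) q) = ε • derivAt d (K a c) q) :
    elemFun i (unitonList K i q) (derivAt (i - a) (K a c) q) ∈
      unitonSucc K i q ⊓ eig (partialMap F₀ K i q) ((-1) ^ i * ε) := by
  have hl := length_unitonList K i q
  set v := derivAt (i - a) (K a c) q with hv
  have key : ∀ u : Ser n, u 0 = v →
      resid (unitonList K i q) ((shift ^ i) u) = elemFun i (unitonList K i q) v := by
    intro u hu
    have := resid_shift_pow_length (unitonList K i q) u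
    rwa [hl, hu] at this
  refine ⟨?_, ?_⟩
  · obtain ⟨u, hu⟩ : jet K r q (i - a) c ∈ LinearMap.range (shift ^ a : Module.End ℂ (Ser n)) :=
      mem_range_shift_pow.2 fun m hm => by rw [jet, if_pos (by omega), hvan m hm]
    have hu0 : u 0 = v := by
      have := congrFun hu a
      rw [shift_pow_apply, if_neg (lt_irrefl a), Nat.sub_self, jet, if_pos (by omega)] at this
      exact this
    rw [SetLike.mem_coe, ← key u hu0, h.unitonSucc_eq hi]
    refine Submodule.mem_map_of_mem ?_
    have e : (shift ^ i) u = (shift ^ (i - a)) (jet K r q (i - a) c) := by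
      rw [← hu, ← Module.End.mul_apply, ← pow_add, Nat.sub_add_cancel ha]
    rw [e]
    exact shift_pow_mem_wSpace _ _ _ le_rfl
  · change _ ∈ eig _ _
    rw [mem_eig, ← key _ (constSer_zero v), h.partialMap_resid hi.le, twist_shift_pow, map_smul,
      mul_smul]
    congr 1
    have e : (twist (cartan F₀) (constSer v)) 0 = ε • v := by
      rw [twist_apply, constSer_zero, pow_zero, one_smul, hε]
    have := resid_shift_pow_length (unitonList K i q) (twist (cartan F₀) (constSer v))
    rw [hl, e, map_smul] at this
    rw [this, key _ (constSer_zero v)]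

lemma proj_topVec (K : ℕ → Fin n → M → Cn n) (i : ℕ) (q : M) (v : Cn n) :
    (unitonSucc K i q).starProjection (elemFun (i + 1) (unitonList K (i + 1) q) v) = 0 := by
  have hl := length_unitonList K i q
  rw [unitonList_succ, elemFun_succ_cons, elemFun_of_length_lt (by omega), zero_add]
  exact DFunLike.congr_fun (proj_mul_perp (unitonSucc K i q)) _

/-- Rank-nullity for the projection to the previous uniton: its image contains the previous
eigenpart, and its kernel contains the new N. -/
lemma sum_finrank_le (h : IsRegularPoint F₀ r K q) {ε : ℂ} (hε : ε * ε = 1)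
    {N : ℕ → Submodule ℂ (Cn n)}
    (hN : ∀ i < r, N i ≤ unitonSucc K i q ⊓ eig (partialMap F₀ K i q) ε)
    (hN' : ∀ i, ∀ v ∈ N (i + 1), (unitonSucc K i q).starProjection v = 0) {i : ℕ} (hi : i < r) :
    ∑ m ∈ Finset.range (i + 1), Module.finrank ℂ (N m) ≤
      Module.finrank ℂ ↥(unitonSucc K i q ⊓ eig (partialMap F₀ K i q) ε) := by
  induction i with
  | zero => simpa using Submodule.finrank_mono (hN 0 hi)
  | succ i ih =>
    rw [Finset.sum_range_succ]
    exact (Nat.add_le_add_right (ih (by omega)) _).trans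
      (finrank_add_le_of_le_map _ (h.le_map_proj hi hε) (hN _ hi) (hN' i))

end IsRegularPoint

/-- The span of the vectors `C^i_i K_{a,c}^{(i-a)}` at `q` with `a ≤ i` and `c` in the `a`-th of the
blocks `B`. -/
def topSpan (K : ℕ → Fin n → M → Cn n) (B : ℕ → Set (Fin n)) (i : ℕ) (q : M) :
    Submodule ℂ (Cn n) :=
  Submodule.span ℂ (⋃ a ∈ Finset.range (i + 1), topVecs K i a (B a) q)

lemma topSpan_le {K : ℕ → Fin n → M → Cn n} {B : ℕ → Set (Fin n)} {i : ℕ} {q : M}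
    {U : Submodule ℂ (Cn n)}
    (h : ∀ a ≤ i, ∀ c ∈ B a, elemFun i (unitonList K i q) (derivAt (i - a) (K a c) q) ∈ U) :
    topSpan K B i q ≤ U := by
  rw [topSpan, Submodule.span_le]
  simp only [Set.iUnion_subset_iff]
  rintro a ha _ ⟨c, hc, rfl⟩
  exact h a (by rw [Finset.mem_range] at ha; omega) c hc

/-- The point `q` is generic for the array `K` and the pair `(l, s)`: it is regular, and all
conditions on ranks and values hold at `q` and near `q`. -/
structure IsGenericPoint (F₀ : Submodule ℂ (Cn n)) (r : ℕ) (l s : ℕ → ℕ → ℕ)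
    (K : ℕ → Fin n → M → Cn n) (q : M) : Prop extends IsRegularPoint F₀ r K q where
  vanish : ∀ a < r, ∀ c ∈ blockL n l s a ∪ blockS n l s a, ∀ m < a, ∀ d, derivAt d (K m c) q = 0
  valued_l : ∀ a < r, ∀ c ∈ blockL n l s a, ∀ d, derivAt d (K a c) q ∈ F₀
  valued_s : ∀ a < r, ∀ c ∈ blockS n l s a, ∀ d, derivAt d (K a c) q ∈ F₀ᗮ
  rank_uniton : ∀ i < r, Module.finrank ℂ (unitonSucc K i q) =
    ∑ m ∈ Finset.range (i + 1), ∑ t ∈ Finset.range (m + 1), (l t (m - t) + s t (m - t))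
  rank_l : ∀ i < r, Module.finrank ℂ (topSpan K (blockL n l s) i q) =
    ∑ a ∈ Finset.range (i + 1), l a (i - a)
  rank_s : ∀ i < r, Module.finrank ℂ (topSpan K (blockS n l s) i q) =
    ∑ a ∈ Finset.range (i + 1), s a (i - a)

lemma eventually_isGenericPoint [IsManifold 𝓘(ℂ) ω M] [T1Space M] {F₀ : Submodule ℂ (Cn n)}
    {r : ℕ} {l s : ℕ → ℕ → ℕ} {K : ℕ → Fin n → M → Cn n} (hK : IsF0Array F₀ r K)
    (hadapted : IsAdapted F₀ r l s K) (hmatch : Matches F₀ r l s K) :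
    ∀ᶠ q in Filter.codiscrete M, IsGenericPoint F₀ r l s K q := by
  have rows {P : ℕ → M → Prop} (h : ∀ i < r, ∀ᶠ q in Filter.codiscrete M, P i q) :
      ∀ᶠ q in Filter.codiscrete M, ∀ i < r, P i q := by
    simpa only [Finset.mem_range] using
      (Filter.eventually_all_finset (Finset.range r)).2 fun i hi => h i (Finset.mem_range.1 hi)
  have hvan : ∀ᶠ q in Filter.codiscrete M, ∀ a < r, ∀ c, ∀ m < r,
      c ∈ blockL n l s a ∪ blockS n l s a → m < a → ∀ᶠ q' in 𝓝 q, K m c q' = 0 :=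
    rows fun a ha => Filter.eventually_all.2 fun c => rows fun m _ =>
      Filter.eventually_imp_distrib_left.2 fun hc => Filter.eventually_imp_distrib_left.2 fun hm =>
        eventually_codiscrete_nhds (hmatch.vanish a ha m hm c hc)
  have hl : ∀ᶠ q in Filter.codiscrete M, ∀ a < r, ∀ c, c ∈ blockL n l s a →
      ∀ᶠ q' in 𝓝 q, K a c q' ∈ F₀ :=
    rows fun a ha => Filter.eventually_all.2 fun c => Filter.eventually_imp_distrib_left.2 fun hc =>
      eventually_codiscrete_nhds (hmatch.valued_l a ha c hc)
  have hs : ∀ᶠ q in Filter.codiscrete M, ∀ a < r, ∀ c, c ∈ blockS n l s a →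
      ∀ᶠ q' in 𝓝 q, K a c q' ∈ F₀ᗮ :=
    rows fun a ha => Filter.eventually_all.2 fun c => Filter.eventually_imp_distrib_left.2 fun hc =>
      eventually_codiscrete_nhds (hmatch.valued_s a ha c hc)
  filter_upwards [hK.eventually_isRegularPoint, hvan, hl, hs, rows hadapted.rank_uniton,
    rows hmatch.rank_sum_l, rows hmatch.rank_sum_s] with q h1 h2 h3 h4 h5 h6 h7
  refine ⟨h1, fun a ha c hc m hm d => ?_, fun a ha c hc d => ?_, fun a ha c hc d => ?_, h5, h6, h7⟩
  · have := derivAt_mem (F := ⊥) (h1.holomorphic m (hm.trans ha) c)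
      ((h2 a ha c m (hm.trans ha) hc hm).mono fun _ h => (Submodule.mem_bot ℂ).2 h) d
    exact (Submodule.mem_bot ℂ).1 this
  · exact derivAt_mem (h1.holomorphic a ha c) (h3 a ha c hc) d
  · exact derivAt_mem (h1.holomorphic a ha c) (h4 a ha c hc) d

namespace IsGenericPoint

variable {F₀ : Submodule ℂ (Cn n)} {r : ℕ} {l s : ℕ → ℕ → ℕ} {K : ℕ → Fin n → M → Cn n} {q : M}

lemma topSpan_blockL_le (h : IsGenericPoint F₀ r l s K q) {i : ℕ} (hi : i < r) :
    topSpan K (blockL n l s) i q ≤ unitonSucc K i q ⊓ eig (partialMap F₀ K i q) ((-1) ^ i) :=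
  topSpan_le fun a ha c hc => by
    have := h.topVec_mem hi ha (h.vanish a (by omega) c (Or.inl hc)) (ε := 1) fun d => by
      rw [cartan_apply_of_mem (h.valued_l a (by omega) c hc d), one_smul]
    rwa [mul_one] at this

lemma topSpan_blockS_le (h : IsGenericPoint F₀ r l s K q) {i : ℕ} (hi : i < r) :
    topSpan K (blockS n l s) i q ≤
      unitonSucc K i q ⊓ eig (partialMap F₀ K i q) ((-1) ^ i * -1) :=
  topSpan_le fun a ha c hc =>
    h.topVec_mem hi ha (h.vanish a (by omega) c (Or.inr hc)) (ε := -1) fun d => by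
      rw [cartan_apply_of_mem_orthogonal (h.valued_s a (by omega) c hc d), neg_one_smul]

lemma proj_topSpan (K : ℕ → Fin n → M → Cn n) (B : ℕ → Set (Fin n)) (i : ℕ) (q : M) (v : Cn n)
    (hv : v ∈ topSpan K B (i + 1) q) : (unitonSucc K i q).starProjection v = 0 := by
  have : topSpan K B (i + 1) q ≤
      LinearMap.ker ((unitonSucc K i q).starProjection : Cn n →ₗ[ℂ] Cn n) :=
    topSpan_le fun a _ c _ => IsRegularPoint.proj_topVec K i q _
  exact this hv

/-- In row m the vectors from F_0 have sign (-1)^m, so l and s exchange roles with the parity of m.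
Both sides are bounded below by the counts, and the counts add up to the rank of the uniton, which
forces equality. -/
lemma finrank_inf_eig (h : IsGenericPoint F₀ r l s K q) {i : ℕ} (hi : i < r) :
    Module.finrank ℂ ↥(unitonSucc K i q ⊓ eig (partialMap F₀ K i q) 1) =
        ∑ m ∈ Finset.range (i + 1), (if Even m then ∑ t ∈ Finset.range (m + 1), l t (m - t)
          else ∑ t ∈ Finset.range (m + 1), s t (m - t)) ∧
      Module.finrank ℂ ↥(unitonSucc K i q ⊓ eig (partialMap F₀ K i q) (-1)) =
        ∑ m ∈ Finset.range (i + 1), (if Even m then ∑ t ∈ Finset.range (m + 1), s t (m - t)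
          else ∑ t ∈ Finset.range (m + 1), l t (m - t)) := by
  have hL (m : ℕ) (hm : m < r) := h.topSpan_blockL_le hm
  have hS (m : ℕ) (hm : m < r) := h.topSpan_blockS_le hm
  have hplus := h.sum_finrank_le (ε := 1) (by norm_num)
    (N := fun m => if Even m then topSpan K (blockL n l s) m q else topSpan K (blockS n l s) m q)
    (fun m hm => by
      split_ifs with he
      · simpa only [he.neg_one_pow] using hL m hm
      · simpa only [(Nat.not_even_iff_odd.1 he).neg_one_pow, neg_mul_neg, one_mul] using hS m hm)
    (fun m v hv => by split_ifs at hv <;> exact proj_topSpan K _ m q v hv) hi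
  have hminus := h.sum_finrank_le (ε := -1) (by norm_num)
    (N := fun m => if Even m then topSpan K (blockS n l s) m q else topSpan K (blockL n l s) m q)
    (fun m hm => by
      split_ifs with he
      · simpa only [he.neg_one_pow, one_mul] using hS m hm
      · simpa only [(Nat.not_even_iff_odd.1 he).neg_one_pow] using hL m hm)
    (fun m v hv => by split_ifs at hv <;> exact proj_topSpan K _ m q v hv) hi
  have e1 : ∀ m ∈ Finset.range (i + 1), Module.finrank ℂ
      ↥(if Even m then topSpan K (blockL n l s) m q else topSpan K (blockS n l s) m q) =
      if Even m then ∑ t ∈ Finset.range (m + 1), l t (m - t)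
          else ∑ t ∈ Finset.range (m + 1), s t (m - t) := fun m hm => by
    rw [Finset.mem_range] at hm
    exact (apply_ite (fun U : Submodule ℂ (Cn n) => Module.finrank ℂ U) (Even m) _ _).trans
      (by rw [h.rank_l m (by omega), h.rank_s m (by omega)])
  have e2 : ∀ m ∈ Finset.range (i + 1), Module.finrank ℂ
      ↥(if Even m then topSpan K (blockS n l s) m q else topSpan K (blockL n l s) m q) =
      if Even m then ∑ t ∈ Finset.range (m + 1), s t (m - t)
          else ∑ t ∈ Finset.range (m + 1), l t (m - t) := fun m hm => by
    rw [Finset.mem_range] at hm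
    exact (apply_ite (fun U : Submodule ℂ (Cn n) => Module.finrank ℂ U) (Even m) _ _).trans
      (by rw [h.rank_l m (by omega), h.rank_s m (by omega)])
  rw [Finset.sum_congr rfl e1] at hplus
  rw [Finset.sum_congr rfl e2] at hminus
  obtain ⟨-, hinv, -, hV⟩ := h.partialMap_spec hi.le
  have htot := finrank_eq_add_finrank_inf_eig hinv (hV hi)
  have hsum : (∑ m ∈ Finset.range (i + 1), ∑ t ∈ Finset.range (m + 1), (l t (m - t) + s t (m - t))) =
      ∑ m ∈ Finset.range (i + 1), (if Even m then ∑ t ∈ Finset.range (m + 1), l t (m - t)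
          else ∑ t ∈ Finset.range (m + 1), s t (m - t)) +
      ∑ m ∈ Finset.range (i + 1), (if Even m then ∑ t ∈ Finset.range (m + 1), s t (m - t)
          else ∑ t ∈ Finset.range (m + 1), l t (m - t)) := by
    rw [← Finset.sum_add_distrib]
    refine Finset.sum_congr rfl fun m _ => ?_
    rw [Finset.sum_add_distrib]
    split_ifs
    exacts [rfl, add_comm _ _]
  rw [h.rank_uniton i hi, hsum] at htot
  omega

lemma finrank_eig_succ (h : IsGenericPoint F₀ r l s K q) {i : ℕ} (hi : i < r) :
    (Module.finrank ℂ (eig (partialMap F₀ K (i + 1) q) 1) : ℤ) +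
        Module.finrank ℂ (eig (partialMap F₀ K i q) 1) =
      n + ∑ m ∈ Finset.range (i + 1), (-1 : ℤ) ^ (m + 1) *
        ∑ t ∈ Finset.range (m + 1), ((s t (m - t) : ℤ) - l t (m - t)) := by
  obtain ⟨-, hinv, -, -⟩ := h.partialMap_spec hi.le
  have hc := h.commute_partialMap hi
  have hc' : Commute (partialMap F₀ K i q) (cartan (unitonSucc K i q)) := by
    rw [cartan, Submodule.starProjection_orthogonal']
    exact hc.sub_right ((Commute.one_right _).sub_right hc)
  have h1 := finrank_eig_mul_cartan hinv hc'
  obtain ⟨h2, h3⟩ := h.finrank_inf_eig hi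
  have e : ∑ m ∈ Finset.range (i + 1), (-1 : ℤ) ^ (m + 1) *
        ∑ t ∈ Finset.range (m + 1), ((s t (m - t) : ℤ) - l t (m - t)) =
      (Module.finrank ℂ ↥(unitonSucc K i q ⊓ eig (partialMap F₀ K i q) 1) : ℤ) -
        Module.finrank ℂ ↥(unitonSucc K i q ⊓ eig (partialMap F₀ K i q) (-1)) := by
    rw [h2, h3]
    push_cast
    rw [← Finset.sum_sub_distrib]
    refine Finset.sum_congr rfl fun m _ => ?_
    rw [Finset.sum_sub_distrib]
    split_ifs with he
    · rw [he.add_one.neg_one_pow]; ring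
    · rw [(Nat.not_even_iff_odd.1 he).add_one.neg_one_pow]; ring
  rw [e]
  change Module.finrank ℂ (eig (partialMap F₀ K (i + 1) q) 1) + _ + _ = _ at h1
  omega

end IsGenericPoint

end RegularPoints

/-! ### Solving the recursion and passing to all points -/

section Ranks

variable {n : ℕ} {M : Type*} [TopologicalSpace M] [ChartedSpace ℂ M]

lemma alternating_sum_even (σ : ℕ → ℤ) (j : ℕ) :
    ∑ m ∈ Finset.range (2 * j), (-1 : ℤ) ^ (m + 1) * σ m =
      ∑ x ∈ Finset.range j, σ (2 * x + 1) - ∑ x ∈ Finset.range j, σ (2 * x) := by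
  induction j with
  | zero => simp
  | succ j ih =>
    rw [show 2 * (j + 1) = 2 * j + 1 + 1 by ring, Finset.sum_range_succ, Finset.sum_range_succ, ih,
      Finset.sum_range_succ, Finset.sum_range_succ, pow_succ, pow_succ, pow_succ, pow_mul]
    simp
    ring

lemma finrank_eig_of_recursion {R : ℕ → ℤ} {σ : ℕ → ℤ} {N k : ℤ} {r : ℕ} (h0 : R 0 = k)
    (h : ∀ i < r, R (i + 1) + R i = N + ∑ m ∈ Finset.range (i + 1), (-1 : ℤ) ^ (m + 1) * σ m)
    (j : ℕ) : (2 * j ≤ r → R (2 * j) = k + ∑ x ∈ Finset.range j, σ (2 * x + 1)) ∧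
      (2 * j + 1 ≤ r → R (2 * j + 1) = N - (k + ∑ x ∈ Finset.range (j + 1), σ (2 * x))) := by
  have odd (j : ℕ) (hj : 2 * j + 1 ≤ r) (hR : R (2 * j) = k + ∑ x ∈ Finset.range j, σ (2 * x + 1)) :
      R (2 * j + 1) = N - (k + ∑ x ∈ Finset.range (j + 1), σ (2 * x)) := by
    have := h (2 * j) hj
    rw [Finset.sum_range_succ, alternating_sum_even, pow_succ, pow_mul] at this
    rw [Finset.sum_range_succ]
    simp only [even_two, Even.neg_pow, one_pow, one_mul, neg_one_mul] at this
    linarith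
  have even (j : ℕ) (hj : 2 * j ≤ r) : R (2 * j) = k + ∑ x ∈ Finset.range j, σ (2 * x + 1) := by
    induction j with
    | zero => simpa using h0
    | succ j ih =>
      have h1 := odd j (by omega) (ih (by omega))
      have h2 := h (2 * j + 1) (by omega)
      rw [show 2 * j + 1 + 1 = 2 * (j + 1) by ring, alternating_sum_even, h1] at h2
      linarith
  exact ⟨even j, fun hj => odd j hj (even j (by omega))⟩

lemma continuous_partialMap {F₀ : Submodule ℂ (Cn n)} {r : ℕ} {K : ℕ → Fin n → M → Cn n}
    (h : ∀ i < r, Continuous fun q => (unitonSucc K i q).starProjection) {i : ℕ} (hi : i ≤ r) :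
    Continuous (partialMap F₀ K i) := by
  induction i with
  | zero => exact continuous_const
  | succ i ih =>
    have hc : Continuous fun q => cartan (unitonSucc K i q) := by
      simp only [cartan, Submodule.starProjection_orthogonal']
      exact (h i hi).sub (continuous_const.sub (h i hi))
    exact (ih (by omega)).mul hc

/-- No point is isolated, so both values are the same limit. -/
lemma eq_of_eventually_codiscrete {Y : Type*} [TopologicalSpace Y] [T2Space Y] {f g : M → Y}
    (hf : Continuous f) (hg : Continuous g) (h : ∀ᶠ q in Filter.codiscrete M, f q = g q) (p : M) :
    f p = g p := by
  have := nhdsNE_neBot_of_chartedSpace p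
  exact tendsto_nhds_unique_of_eventuallyEq (hf.continuousAt.mono_left nhdsWithin_le_nhds)
    (hg.continuousAt.mono_left nhdsWithin_le_nhds) (eventually_codiscrete_iff.1 h p)

variable [IsManifold 𝓘(ℂ) ω M] [T1Space M] {F₀ : Submodule ℂ (Cn n)} {r : ℕ} {l s : ℕ → ℕ → ℕ}
  {K : ℕ → Fin n → M → Cn n}

lemma partialMap_involution (hK : IsF0Array F₀ r K) {i : ℕ} (hi : i ≤ r) (p : M) :
    IsSelfAdjoint (partialMap F₀ K i p) ∧ partialMap F₀ K i p * partialMap F₀ K i p = 1 := by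
  have hφ : Continuous (partialMap F₀ K i) :=
    continuous_partialMap (unitonSucc_regular hK.meromorphic).1 hi
  have hreg := hK.eventually_isRegularPoint
  exact ⟨eq_of_eventually_codiscrete (ContinuousLinearMap.adjoint.continuous.comp hφ) hφ
      (hreg.mono fun q hq => (hq.partialMap_spec hi).1) p,
    eq_of_eventually_codiscrete (hφ.mul hφ) continuous_const
      (hreg.mono fun q hq => (hq.partialMap_spec hi).2.1) p⟩

/-- The rank is (trace φ_i + n)/2, and the trace is continuous. -/
lemma continuous_finrank_eig_partialMap (hK : IsF0Array F₀ r K) {i : ℕ} (hi : i ≤ r) :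
    Continuous fun q => (Module.finrank ℂ (eig (partialMap F₀ K i q) 1) : ℂ) := by
  have hφ : Continuous (partialMap F₀ K i) :=
    continuous_partialMap (unitonSucc_regular hK.meromorphic).1 hi
  have hlin : Continuous ((LinearMap.trace ℂ (Cn n)) ∘ₗ
      (ContinuousLinearMap.coeLM ℂ : (Cn n →L[ℂ] Cn n) →ₗ[ℂ] (Cn n →ₗ[ℂ] Cn n))) :=
    LinearMap.continuous_of_finiteDimensional _
  refine
    (((hlin.comp hφ).add (continuous_const (y := (n : ℂ)))).div_const 2).congr fun q => ?_
  obtain ⟨hsa, hinv⟩ := partialMap_involution hK hi q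
  have h := trace_eq_finrank_eig hsa hinv
  change (LinearMap.trace ℂ (Cn n) (partialMap F₀ K i q : Cn n →ₗ[ℂ] Cn n) + n) / 2 = _
  rw [h]
  ring

lemma finrank_eig_partialMap_succ (hK : IsF0Array F₀ r K) (hadapted : IsAdapted F₀ r l s K)
    (hmatch : Matches F₀ r l s K) {i : ℕ} (hi : i < r) (p : M) :
    (Module.finrank ℂ (eig (partialMap F₀ K (i + 1) p) 1) : ℤ) +
        Module.finrank ℂ (eig (partialMap F₀ K i p) 1) =
      n + ∑ m ∈ Finset.range (i + 1), (-1 : ℤ) ^ (m + 1) *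
        ∑ t ∈ Finset.range (m + 1), ((s t (m - t) : ℤ) - l t (m - t)) := by
  have h := eq_of_eventually_codiscrete
    ((continuous_finrank_eig_partialMap hK (i := i + 1) hi).add
      (continuous_finrank_eig_partialMap hK hi.le))
    (continuous_const (y := ((n + ∑ m ∈ Finset.range (i + 1), (-1 : ℤ) ^ (m + 1) *
      ∑ t ∈ Finset.range (m + 1), ((s t (m - t) : ℤ) - l t (m - t)) : ℤ) : ℂ)))
    ((eventually_isGenericPoint hK hadapted hmatch).mono fun q hq => by
      rw [← hq.finrank_eig_succ hi]
      push_cast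
      rfl) p
  exact Int.cast_injective (α := ℂ) (by rw [← h]; push_cast; rfl)

end Ranks

end GrassUniton

end

theorem mainTheorem4 {M : Type*} [TopologicalSpace M] [T2Space M] [ConnectedSpace M]
    [ChartedSpace ℂ M] [IsManifold 𝓘(ℂ) ω M]
    (n r k : ℕ) (hr : 1 ≤ r) (hrn : r < n)
    (F₀ : Submodule ℂ (GrassUniton.Cn n)) (hk : Module.finrank ℂ F₀ = k)
    (l s : ℕ → ℕ → ℕ)
    (K : ℕ → Fin n → M → GrassUniton.Cn n)
    (hK : GrassUniton.IsF0Array F₀ r K)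
    (hadapted : GrassUniton.IsAdapted F₀ r l s K)
    (hmatch : GrassUniton.Matches F₀ r l s K)
    (i : ℕ) (hi : i ≤ r) (p : M) :
    GrassUniton.partialMap F₀ K i p =
        GrassUniton.cartan (GrassUniton.tautological (GrassUniton.partialMap F₀ K i) p) ∧
      (Even i →
        (Module.finrank ℂ (GrassUniton.tautological (GrassUniton.partialMap F₀ K i) p) : ℤ) =
          k + ∑ j ∈ Finset.range (i / 2), ∑ t ∈ Finset.range (2 * j + 2),
            ((s t (2 * j + 1 - t) : ℤ) - (l t (2 * j + 1 - t) : ℤ))) ∧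
      (Odd i →
        (Module.finrank ℂ (GrassUniton.tautological (GrassUniton.partialMap F₀ K i) p) : ℤ) =
          n - (k + ∑ j ∈ Finset.range ((i - 1) / 2 + 1), ∑ t ∈ Finset.range (2 * j + 1),
            ((s t (2 * j - t) : ℤ) - (l t (2 * j - t) : ℤ)))) := by
  have hrank := GrassUniton.finrank_eig_of_recursion
    (k := k)
    (R := fun i => (Module.finrank ℂ (GrassUniton.eig (GrassUniton.partialMap F₀ K i p) 1) : ℤ))
    (by rw [← hk, show GrassUniton.partialMap F₀ K 0 p = GrassUniton.cartan F₀ from rfl,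
      GrassUniton.eig_cartan])
    fun i hi => GrassUniton.finrank_eig_partialMap_succ hK hadapted hmatch hi p
  obtain ⟨hsa, hinv⟩ := GrassUniton.partialMap_involution hK hi p
  refine ⟨GrassUniton.eq_cartan_eig hsa hinv, ?_, ?_⟩
  · rintro ⟨j, rfl⟩
    have := (hrank j).1 (by omega)
    rw [show (j + j) / 2 = j by omega, show j + j = 2 * j by ring]
    exact this
  · rintro ⟨j, rfl⟩
    have := (hrank j).2 hi
    rw [show (2 * j + 1 - 1) / 2 = j by omega]
    exact this
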